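/- **Model.** An advertiser uses $N\ge 1$ sites. At site $n$ time is divided into consecutive frames $k=0,1,2,\dots$, the first one starting at time $0$. At the beginning of frame $k$ the advertiser chooses, from the information available at that time (possibly with randomization), an investment and a freeze time $(p_n[k],T^{\rm fr}_n[k])$ in a compact set $\mathcal P_n\subset[0,p_n^{\max}]\times[0,T_n^{\rm fr,\max}]$ that contains a point with investment $0$, and a configuration $m_n[k]$ in a compact space $\mathcal M_n$. The frame has length $T_n[k]=T^{\rm ad}_n[k]+T^{\rm fr}_n[k]$, where $T_n^{\rm ad}[k]\ge0$ is random, and brings a random revenue $R_n[k]$. The conditional law of $(T^{\rm ad}_n[k],R_n[k])$ given the information at the beginning of the frame depends only on the chosen $(p,m)=(p_n[k],m_n[k])$ (and on $n,k$), with means $F_n(p,m)$ and $G_n(p,m)$ that do not depend on $k$. For all feasible actions $0<T_n^{\min}\le T_n[k]\le T_n^{\max}$ and $|R_n[k]|\le R_n^{\max}$ almost surely, $G_n(0,\cdot)=0$, $0\le G_n(p,m)\le \nu p$ with a constant $\nu\ge0$, and $G_n(p,m)<G^{\max}$. Put $T^{\min}=\min_nT_n^{\min}$, $T^{\max}=\max_nT_n^{\max}$.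 For a strategy let $$\text{Profit}_{\rm av}=\sum_n\frac{\lim_K\frac1K\sum_{k<K}R_n[k]}{\lim_K\frac1K\sum_{k<K}T_n[k]},\qquad \text{Cost}_{\rm av}=\sum_n\frac{\lim_K\frac1K\sum_{k<K}p_n[k]}{\lim_K\frac1K\sum_{k<K}T_n[k]};$$ all these limits are assumed to exist with probability $1$. A strategy is feasible for the budget $B_{\rm av}\ge0$ if $\text{Cost}_{\rm av}\le B_{\rm av}$ almost surely, and $\text{Profit}^*_{\rm av}$ is the supremum of the (expected) value of $\text{Profit}_{\rm av}$ over all feasible strategies. **Algorithm.** Let $\hat G_n,\hat F_n$ be (measurable) estimates with $|\hat G_n-G_n|\le\rho_GG_n$ and $|\hat F_n-F_n|\le\rho_FF_n$ at all feasible $(p,m)$, where $\rho_G,\rho_F\in[0,1)$. Let $0=t_0<t_1<\dots$ be the times at which a frame begins at some site, $\delta_d=t_{d+1}-t_d$, and let $k_n(t)$ be the index of the frame in which site $n$ is at time $t$. The estimated deficit queue is defined by $Q(t_0)=0$ and $$Q(t_{d+1})=\max[Q(t_d)-\delta_dB_{\rm av},0]+\delta_d\sum_n\frac{p_n[k_n(t_d)]}{\hat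 F_n(p_n[k_n(t_d)],m_n[k_n(t_d)])+T_n^{\rm fr}[k_n(t_d)]}.$$ The Ad-Investment algorithm (AI) with parameter $V\ge1$ chooses, at every $t_d$ and for every site $n$ that begins a frame at $t_d$, a feasible action that maximizes $\dfrac{V\hat G_n(p,m)-Q(t_d)p}{\hat F_n(p,m)+T^{\rm fr}}$ over $(p,T^{\rm fr})\in\mathcal P_n$, $m\in\mathcal M_n$. **Theorem.** There is a constant $C>0$ that depends only on $N,B_{\rm av},\rho_G,\rho_F$ and the bounds $p_n^{\max},T_n^{\rm fr,\max},T_n^{\min},T_n^{\max}$ (in particular not on $V$) such that under AI, for all $V\ge1$: (a) almost surely $$\text{Profit}^{\rm AI}_{\rm av}\ \ge\ \frac{1-\rho_F}{(1+\rho_F)(1+\rho_G)}\,\text{Profit}^*_{\rm av}-\frac CV-\frac{N\rho_GG^{\max}}{(1+\rho_G)T^{\min}};$$ (b) almost surely, for all $d$, $$Q(t_d)\le V(1+\rho_G)\nu+2\hat c_{\max},\qquad \hat c_{\max}=(1+\rho_F)\,T^{\max}\max\Big[\sum_n\frac{p_n^{\max}}{(1-\rho_F)T_n^{\min}},\,B_{\rm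 av}\Big],$$ and, almost surely, $\text{Cost}^{\rm AI}_{\rm av}\le(1+\rho_F)B_{\rm av}$. -/

import Mathlib

open MeasureTheory ProbabilityTheory Filter Topology

universe u v

noncomputable section

/-- The scalar bounds of a system of `N` sites: maximal investments, maximal freeze times,
minimal and maximal frame lengths. -/
structure Bounds (N : ℕ) where
  pmax : Fin N → ℝ
  frmax : Fin N → ℝ
  Tmin : Fin N → ℝ
  Tmax : Fin N → ℝ
  Tmin_pos : ∀ n, 0 < Tmin n

/-- `T^min`, the minimum over the sites of the minimal frame lengths. -/
def Bounds.TminAll {N : ℕ} (b : Bounds N) : ℝ := ⨅ n, b.Tmin n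

/-- `T^max`, the maximum over the sites of the maximal frame lengths. -/
def Bounds.TmaxAll {N : ℕ} (b : Bounds N) : ℝ := ⨆ n, b.Tmax n

/-- The sponsored search system: the feasible (investment, freeze time) sets `P n`, the compact
configuration spaces `M n`, and the random dynamics of the sites. If at site `n` the investment `p`
is made under the configuration `m` for frame `k`, then the pair (time taken to deplete the
investment, revenue earned) has the law `outcome n k (p, m)`, whose means are `F n p m`, `G n p m`. -/
structure AdSystem {N : ℕ} (b : Bounds N) (M : Fin N → Type u)
    [∀ n, TopologicalSpace (M n)] [∀ n, CompactSpace (M n)]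
    [∀ n, MeasurableSpace (M n)] [∀ n, BorelSpace (M n)] where
  P : Fin N → Set (ℝ × ℝ)
  P_compact : ∀ n, IsCompact (P n)
  P_zero : ∀ n, ∃ fr, ((0 : ℝ), fr) ∈ P n
  P_bounds : ∀ n p fr, (p, fr) ∈ P n → 0 ≤ p ∧ p ≤ b.pmax n ∧ 0 ≤ fr ∧ fr ≤ b.frmax n
  outcome : (n : Fin N) → ℕ → Kernel (ℝ × M n) (ℝ × ℝ)
  outcome_markov : ∀ n k, IsMarkovKernel (outcome n k)
  F : (n : Fin N) → ℝ → M n → ℝ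
  G : (n : Fin N) → ℝ → M n → ℝ
  ν : ℝ
  Gmax : ℝ
  Rmax : Fin N → ℝ
  /-- Depletion times are nonnegative, and the frame length is between its bounds. -/
  time_bounds : ∀ n k p fr m, (p, fr) ∈ P n → ∀ᵐ x ∂(outcome n k (p, m)),
    0 ≤ x.1 ∧ b.Tmin n ≤ x.1 + fr ∧ x.1 + fr ≤ b.Tmax n
  revenue_bound : ∀ n k p fr m, (p, fr) ∈ P n → ∀ᵐ x ∂(outcome n k (p, m)), |x.2| ≤ Rmax n
  mean_time : ∀ n k p fr m, (p, fr) ∈ P n → ∫ x, x.1 ∂(outcome n k (p, m)) = F n p m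
  mean_revenue : ∀ n k p fr m, (p, fr) ∈ P n → ∫ x, x.2 ∂(outcome n k (p, m)) = G n p m
  G_zero : ∀ n m, G n 0 m = 0
  G_nonneg : ∀ n p fr m, (p, fr) ∈ P n → 0 ≤ G n p m
  ν_nonneg : 0 ≤ ν
  G_le : ∀ n p fr m, (p, fr) ∈ P n → G n p m ≤ ν * p
  G_lt : ∀ n p fr m, (p, fr) ∈ P n → G n p m < Gmax

/-- Beginning of frame `k` of a site with depletion times `T` and freeze times `fr`. -/
def frameStart {Ω : Type v} (T fr : ℕ → Ω → ℝ) (k : ℕ) (ω : Ω) : ℝ :=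
  ∑ j ∈ Finset.range k, (T j ω + fr j ω)

variable {N : ℕ} {b : Bounds N} {M : Fin N → Type u}
  [∀ n, TopologicalSpace (M n)] [∀ n, CompactSpace (M n)]
  [∀ n, MeasurableSpace (M n)] [∀ n, BorelSpace (M n)]
  {Ω : Type v} [mΩ : MeasurableSpace Ω]

/-- The system operated under some (possibly randomized and history dependent) investment strategy.
All sites start their frame `0` at time `0`. The filtration `ℱ` is the information available to the
advertiser over time. The actions of frame `k` of site `n` are chosen in the feasible sets, from the
information at the beginning of the frame; given that information, the (depletion time, revenue) of
the frame has the law that the site prescribes for the chosen investment and configuration. -/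
structure AdProcess (sys : AdSystem b M) (μ : Measure Ω) where
  p : Fin N → ℕ → Ω → ℝ
  fr : Fin N → ℕ → Ω → ℝ
  m : (n : Fin N) → ℕ → Ω → M n
  Tad : Fin N → ℕ → Ω → ℝ
  R : Fin N → ℕ → Ω → ℝ
  ℱ : Filtration ℝ mΩ
  Tad_nonneg : ∀ n k ω, 0 ≤ Tad n k ω
  action_mem : ∀ n k ω, (p n k ω, fr n k ω) ∈ sys.P n
  isStoppingTime_start : ∀ n k,
    IsStoppingTime ℱ (fun ω => ((frameStart (Tad n) (fr n) k ω : ℝ) : WithTop ℝ))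
  p_meas : ∀ n k, Measurable[(isStoppingTime_start n k).measurableSpace] (p n k)
  fr_meas : ∀ n k, Measurable[(isStoppingTime_start n k).measurableSpace] (fr n k)
  m_meas : ∀ n k, Measurable[(isStoppingTime_start n k).measurableSpace] (m n k)
  Tad_meas : ∀ n k, Measurable[(isStoppingTime_start n (k + 1)).measurableSpace] (Tad n k)
  R_meas : ∀ n k, Measurable[(isStoppingTime_start n (k + 1)).measurableSpace] (R n k)
  outcome_law : ∀ n k (A : Set Ω), MeasurableSet[(isStoppingTime_start n k).measurableSpace] A →
    ∀ S : Set (ℝ × ℝ), MeasurableSet S →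
      μ (A ∩ {ω | (Tad n k ω, R n k ω) ∈ S})
        = ∫⁻ ω in A, sys.outcome n k (p n k ω, m n k ω) S ∂μ

/-- The average `(1/K) ∑_{k<K} x k`. -/
def avg (x : ℕ → ℝ) (K : ℕ) : ℝ := (1 / (K : ℝ)) * ∑ k ∈ Finset.range K, x k

namespace AdProcess

variable {sys : AdSystem b M} {μ : Measure Ω} (X : AdProcess sys μ)

/-- Beginning of frame `k` of site `n`. -/
def start (n : Fin N) (k : ℕ) (ω : Ω) : ℝ := frameStart (X.Tad n) (X.fr n) k ω

/-- Length of frame `k` of site `n`. -/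
def frameLen (n : Fin N) (k : ℕ) (ω : Ω) : ℝ := X.Tad n k ω + X.fr n k ω

/-- With probability one, all the time averages that enter the average revenue and the average
expenditure converge. -/
def HasTimeAverages : Prop :=
  ∀ᵐ ω ∂μ, ∀ n,
    (∃ l, Tendsto (avg fun k => X.R n k ω) atTop (𝓝 l)) ∧
    (∃ l, Tendsto (avg fun k => X.p n k ω) atTop (𝓝 l)) ∧
    (∃ l, Tendsto (avg fun k => X.frameLen n k ω) atTop (𝓝 l))

/-- Time average revenue. -/
def profit (ω : Ω) : ℝ :=
  ∑ n, limUnder atTop (avg fun k => X.R n k ω) / limUnder atTop (avg fun k => X.frameLen n k ω)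

/-- Time average expenditure. -/
def expenditure (ω : Ω) : ℝ :=
  ∑ n, limUnder atTop (avg fun k => X.p n k ω) / limUnder atTop (avg fun k => X.frameLen n k ω)

/-- The strategy satisfies the average budget constraint with budget `B`, almost surely. -/
def Feasible (B : ℝ) : Prop :=
  X.HasTimeAverages ∧ ∀ᵐ ω ∂μ, X.expenditure ω ≤ B

/-- The decision points: `t 0 = 0`, and `t (d + 1)` is the first beginning of a frame of any site
after `t d`. -/
def t : ℕ → Ω → ℝ
  | 0, _ => 0
  | d + 1, ω => sInf {s | t d ω < s ∧ ∃ n k, s = X.start n k ω}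

/-- `δ_d`, the time between two decision points. -/
def δ (d : ℕ) (ω : Ω) : ℝ := X.t (d + 1) ω - X.t d ω

/-- Index of the frame in which site `n` is at time `s`. -/
def frameIdx (n : Fin N) (s : ℝ) (ω : Ω) : ℕ := sSup {k | X.start n k ω ≤ s}

/-- Site `n` starts a new frame at the decision point `t d`. -/
def Starts (n : Fin N) (d : ℕ) (ω : Ω) : Prop := ∃ k, X.start n k ω = X.t d ω

/-- Effective budget consumption rate at the decision point `t d`, computed with the estimated
mean depletion times `Fh`. -/
def rate (Fh : (n : Fin N) → ℝ → M n → ℝ) (n : Fin N) (d : ℕ) (ω : Ω) : ℝ :=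
  let k := X.frameIdx n (X.t d ω) ω
  X.p n k ω / (Fh n (X.p n k ω) (X.m n k ω) + X.fr n k ω)

/-- The deficit queue at the decision points, computed with the estimates `Fh`. -/
def Q (Fh : (n : Fin N) → ℝ → M n → ℝ) (B : ℝ) : ℕ → Ω → ℝ
  | 0, _ => 0
  | d + 1, ω => max (Q Fh B d ω - X.δ d ω * B) 0 + X.δ d ω * ∑ n, X.rate Fh n d ω

/-- The process is operated by the Ad-Investment algorithm with the estimates `Gh`, `Fh`, budget `B`
and parameter `V`: at every decision point, each site that starts a new frame uses a feasible action
that maximizes `(V Gh(p, m) - Q p) / (Fh(p, m) + fr)`. -/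
def IsAdInvestment (Gh Fh : (n : Fin N) → ℝ → M n → ℝ) (B V : ℝ) : Prop :=
  ∀ᵐ ω ∂μ, ∀ d n, X.Starts n d ω →
    let k := X.frameIdx n (X.t d ω) ω
    ∀ p' fr' m', (p', fr') ∈ sys.P n →
      (V * Gh n p' m' - X.Q Fh B d ω * p') / (Fh n p' m' + fr')
        ≤ (V * Gh n (X.p n k ω) (X.m n k ω) - X.Q Fh B d ω * X.p n k ω)
            / (Fh n (X.p n k ω) (X.m n k ω) + X.fr n k ω)

end AdProcess

/-- `Profit*_av`: the supremum of the (expected) time average revenue over all feasible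
strategies. -/
def AdSystem.optProfit (sys : AdSystem b M) (B : ℝ) : ℝ :=
  sSup {x : ℝ | ∃ (Ω : Type u) (_ : MeasurableSpace Ω) (μ : Measure Ω) (_ : IsProbabilityMeasure μ)
    (X : AdProcess sys μ), X.Feasible B ∧ x = ∫ ω, X.profit ω ∂μ}

/-- The estimates `Gh`, `Fh` of `G`, `F` are measurable and have relative errors at most
`ρG`, `ρF`. -/
structure AdSystem.EstimationQuality (sys : AdSystem b M)
    (Gh Fh : (n : Fin N) → ℝ → M n → ℝ) (ρG ρF : ℝ) : Prop where
  Gh_meas : ∀ n, Measurable (Function.uncurry (Gh n))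
  Fh_meas : ∀ n, Measurable (Function.uncurry (Fh n))
  Gh_err : ∀ n p fr m, (p, fr) ∈ sys.P n → |Gh n p m - sys.G n p m| ≤ ρG * sys.G n p m
  Fh_err : ∀ n p fr m, (p, fr) ∈ sys.P n → |Fh n p m - sys.F n p m| ≤ ρF * sys.F n p m

/-- The bound `ĉ_max` on the change of the estimated deficit queue. -/
def Bounds.cmaxHat (b : Bounds N) (B ρF : ℝ) : ℝ :=
  (1 + ρF) * b.TmaxAll * max (∑ n, b.pmax n / ((1 - ρF) * b.Tmin n)) B

end

/-!
# Performance of the Ad-Investment algorithm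

The proof works along almost every path; the probabilistic input is a strong law of large numbers
(`ae_tendsto_avg_zero`). Given the information at the beginning of a frame, the depletion time and
the revenue have the means `F` and `G` of the chosen action, so the differences from these means are
bounded martingale differences and average out, also after multiplication by a bounded function of
the action (`AdProcess.ae_tendsto_avg_outcome`). Since the decision points `t d` partition the
frames of every site, this turns time integrals of a function of the running frames into averages
over frames (`AdProcess.IsRegular.exists_time_avg_le`).

*The optimum.* It enters only through weak duality (`AdSystem.optProfit_le`): if at a price
`lam ≥ 0` of investments no action of site `n` has net revenue `G - lam * p` above
`c n * (F + fr)`, then no feasible strategy earns more than `lam * B + ∑ n, c n`.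

*The queue.* While it exceeds `V * (1 + ρG) * ν`, sites which start a frame do not invest, so that
only the frames already running can increase it; hence it is bounded (`AdProcess.IsRegular.Q_le`).
The queue dominates the accumulated consumption minus the accumulated budget, so the average
estimated consumption rate is at most `B`. The estimates underrate the consumption by a factor of at
most `1 + ρF`.

*The profit.* The queue changes at a bounded rate, so at every decision point the action of the
running frame of each site maximizes `V * Gh - Q * p` per unit of estimated frame length up to a
constant (`AdProcess.IsRegular.nearly_optimal`). Integrated over time, this says that with the price
`lam = (time average of Q) / V` the estimated net revenue rate of every fixed action is at most an
average over the running frames. These averages are therefore admissible in the dual bound, after a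
correction for the estimation errors. The term `lam * B` that remains there is compensated by the
drift of `Q ^ 2` (`AdProcess.IsRegular.drift`), which bounds from below the time average of `Q`
times the excess of consumption over the budget. The result is
`AdProcess.IsRegular.optProfit_le`; the number of decision points then tends to infinity.
-/

noncomputable section

/-! ### A strong law for bounded martingale differences -/

section StrongLaw

lemma avg_eq (x : ℕ → ℝ) (K : ℕ) : avg x K = (∑ k ∈ Finset.range K, x k) / K := by
  rw [avg]; ring

/-- Averages of a bounded sequence converge to zero as soon as they do so along the squares: the
blocks between consecutive squares are too short to matter. -/
lemma tendsto_avg_zero_of_squares {y : ℕ → ℝ} {c : ℝ} (hy : ∀ k, |y k| ≤ c)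
    (h : Tendsto (fun j : ℕ => avg y ((j + 1) ^ 2)) atTop (𝓝 0)) :
    Tendsto (avg y) atTop (𝓝 0) := by
  have hc : 0 ≤ c := (abs_nonneg _).trans (hy 0)
  have hsq : Tendsto (fun K : ℕ => Nat.sqrt K - 1) atTop atTop := by
    refine tendsto_atTop.2 fun a => eventually_atTop.2 ⟨(a + 1) ^ 2, fun K hK => ?_⟩
    have := Nat.le_sqrt'.2 hK
    omega
  have h1 : Tendsto (fun K : ℕ => |avg y ((Nat.sqrt K - 1 + 1) ^ 2)|
      + 2 * c / ((Nat.sqrt K - 1 : ℕ) + 1 : ℝ)) atTop (𝓝 0) := by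
    have h2 : Tendsto (fun j : ℕ => |avg y ((j + 1) ^ 2)| + 2 * c / ((j : ℝ) + 1))
        atTop (𝓝 (|0| + 0)) :=
      h.abs.add ((tendsto_natCast_atTop_atTop.atTop_add tendsto_const_nhds).const_div_atTop _)
    rw [abs_zero, add_zero] at h2
    exact h2.comp hsq
  refine squeeze_zero_norm' ?_ h1
  filter_upwards [eventually_ge_atTop 1] with K hK
  obtain ⟨j, hj⟩ : ∃ j, Nat.sqrt K = j + 1 :=
    ⟨Nat.sqrt K - 1, by have := Nat.sqrt_pos.2 hK; omega⟩
  have hle : (j + 1) ^ 2 ≤ K := by rw [← hj]; exact Nat.sqrt_le' K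
  have hlt : K < (j + 2) ^ 2 := by
    have := Nat.lt_succ_sqrt' K
    rwa [hj] at this
  rw [hj, Nat.add_sub_cancel, Real.norm_eq_abs]
  have hsplit : ∑ k ∈ Finset.range K, y k = ∑ k ∈ Finset.range ((j + 1) ^ 2), y k
      + ∑ k ∈ Finset.Ico ((j + 1) ^ 2) K, y k := (Finset.sum_range_add_sum_Ico _ hle).symm
  have hblock : |∑ k ∈ Finset.Ico ((j + 1) ^ 2) K, y k| ≤ 2 * c * (j + 1) := by
    calc |∑ k ∈ Finset.Ico ((j + 1) ^ 2) K, y k|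
        ≤ ∑ k ∈ Finset.Ico ((j + 1) ^ 2) K, |y k| := Finset.abs_sum_le_sum_abs _ _
      _ ≤ ∑ _k ∈ Finset.Ico ((j + 1) ^ 2) K, c := Finset.sum_le_sum fun k _ => hy k
      _ = ((K - (j + 1) ^ 2 : ℕ) : ℝ) * c := by simp
      _ ≤ (2 * (j + 1)) * c := by
          gcongr
          have : K - (j + 1) ^ 2 ≤ 2 * (j + 1) := by
            have : (j + 2) ^ 2 = (j + 1) ^ 2 + 2 * (j + 1) + 1 := by ring
            omega
          exact_mod_cast this
      _ = 2 * c * (j + 1) := by ring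
  have hjpos : (0 : ℝ) < (j : ℝ) + 1 := by positivity
  have hKj : ((j : ℝ) + 1) ^ 2 ≤ K := by exact_mod_cast hle
  have hKpos : (0 : ℝ) < K := by positivity
  rw [avg_eq, avg_eq, hsplit, abs_div, abs_div, abs_of_pos hKpos]
  push_cast
  rw [abs_of_pos (by positivity : (0 : ℝ) < ((j : ℝ) + 1) ^ 2)]
  calc |∑ k ∈ Finset.range ((j + 1) ^ 2), y k + ∑ k ∈ Finset.Ico ((j + 1) ^ 2) K, y k| / (K : ℝ)
      ≤ (|∑ k ∈ Finset.range ((j + 1) ^ 2), y k| + 2 * c * (j + 1)) / ((j : ℝ) + 1) ^ 2 := by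
        gcongr
        exact (abs_add_le _ _).trans (by gcongr)
    _ = _ := by field_simp

variable {Ω : Type*} {mΩ : MeasurableSpace Ω} {μ : Measure Ω} [IsProbabilityMeasure μ]

/-- Strong law of large numbers for bounded martingale differences. That `Y k` has conditional mean
zero given `𝓖 k` is expressed by its orthogonality to the bounded `𝓖 k`-measurable functions. The
second moments of the averages along the squares are then summable. -/
lemma ae_tendsto_avg_zero {𝓖 : ℕ → MeasurableSpace Ω} (hmono : Monotone 𝓖) (hle : ∀ k, 𝓖 k ≤ mΩ)
    {Y : ℕ → Ω → ℝ} {c : ℝ} (hmeas : ∀ k, Measurable[𝓖 (k + 1)] (Y k))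
    (hb : ∀ k, ∀ᵐ ω ∂μ, |Y k ω| ≤ c)
    (horth : ∀ k (Z : Ω → ℝ), Measurable[𝓖 k] Z → (∃ C, ∀ᵐ ω ∂μ, |Z ω| ≤ C) →
      ∫ ω, Z ω * Y k ω ∂μ = 0) :
    ∀ᵐ ω ∂μ, Tendsto (avg fun k => Y k ω) atTop (𝓝 0) := by
  have hb' : ∀ᵐ ω ∂μ, ∀ k, |Y k ω| ≤ c := ae_all_iff.2 hb
  have hYm : ∀ k, Measurable (Y k) := fun k => (hmeas k).mono (hle _) le_rfl
  set S : ℕ → Ω → ℝ := fun K ω => ∑ k ∈ Finset.range K, Y k ω with hS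
  have hSm : ∀ K, Measurable[𝓖 K] (S K) := fun K =>
    Finset.measurable_sum _ fun k hk =>
      (hmeas k).mono (hmono (Nat.succ_le_of_lt (Finset.mem_range.1 hk))) le_rfl
  have hSm' : ∀ K, Measurable (S K) := fun K => (hSm K).mono (hle _) le_rfl
  have hSb : ∀ K, ∀ᵐ ω ∂μ, |S K ω| ≤ K * c := by
    intro K
    filter_upwards [hb'] with ω h
    calc |S K ω| ≤ ∑ k ∈ Finset.range K, |Y k ω| := Finset.abs_sum_le_sum_abs _ _
      _ ≤ ∑ _k ∈ Finset.range K, c := Finset.sum_le_sum fun k _ => h k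
      _ = K * c := by simp
  have hSi : ∀ K, Integrable (fun ω => S K ω ^ 2) μ := by
    intro K
    refine Integrable.of_bound ((hSm' K).pow_const 2).aestronglyMeasurable ((K * c) ^ 2) ?_
    filter_upwards [hSb K] with ω h
    rw [Real.norm_eq_abs, abs_pow]
    gcongr
  have hSYi : ∀ K, Integrable (fun ω => S K ω * Y K ω) μ := by
    intro K
    refine Integrable.of_bound ((hSm' K).mul (hYm K)).aestronglyMeasurable (K * c * c) ?_
    filter_upwards [hSb K, hb K] with ω h h'
    rw [Real.norm_eq_abs, abs_mul]
    gcongr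
    exact (abs_nonneg _).trans h
  have hYi : ∀ K, Integrable (fun ω => Y K ω ^ 2) μ := by
    intro K
    refine Integrable.of_bound ((hYm K).pow_const 2).aestronglyMeasurable (c ^ 2) ?_
    filter_upwards [hb K] with ω h
    rw [Real.norm_eq_abs, abs_pow]
    gcongr
  have hYle : ∀ K, ∫ ω, Y K ω ^ 2 ∂μ ≤ c ^ 2 := by
    intro K
    calc ∫ ω, Y K ω ^ 2 ∂μ ≤ ∫ _ω, c ^ 2 ∂μ := by
          refine integral_mono_ae (hYi K) (integrable_const _) ?_
          filter_upwards [hb K] with ω h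
          exact sq_le_sq' (neg_le_of_abs_le h) (le_of_abs_le h)
      _ = c ^ 2 := by simp
  have hvar : ∀ K : ℕ, ∫ ω, S K ω ^ 2 ∂μ ≤ K * c ^ 2 := by
    intro K
    induction K with
    | zero => simp [hS]
    | succ K ih =>
      have h1 : ∀ ω, S (K + 1) ω ^ 2 = S K ω ^ 2 + 2 * (S K ω * Y K ω) + Y K ω ^ 2 := by
        intro ω
        simp only [hS, Finset.sum_range_succ]
        ring
      simp_rw [h1]
      have hsum : ∫ ω, (S K ω ^ 2 + 2 * (S K ω * Y K ω) + Y K ω ^ 2) ∂μ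
          = ∫ ω, S K ω ^ 2 ∂μ + 2 * ∫ ω, S K ω * Y K ω ∂μ + ∫ ω, Y K ω ^ 2 ∂μ := by
        have e1 := integral_add ((hSi K).add ((hSYi K).const_mul 2)) (hYi K)
        have e2 := integral_add (hSi K) ((hSYi K).const_mul 2)
        simp only [Pi.add_apply] at e1 e2
        rw [e1, e2, integral_const_mul]
      rw [hsum, horth K (S K) (hSm K) ⟨_, hSb K⟩]
      push_cast
      linarith [hYle K]
  have hfin : ∀ᵐ ω ∂μ, Tendsto (fun j : ℕ => avg (fun k => Y k ω) ((j + 1) ^ 2)) atTop (𝓝 0) := by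
    set f : ℕ → Ω → ℝ := fun j ω => (avg (fun k => Y k ω) ((j + 1) ^ 2)) ^ 2 with hf
    have hfS : ∀ j ω, f j ω = (1 / ((j : ℝ) + 1) ^ 4) * S ((j + 1) ^ 2) ω ^ 2 := by
      intro j ω
      simp only [hf, hS, avg_eq]
      push_cast
      field_simp
    have hfi : ∀ j, Integrable (f j) μ := by
      intro j
      have := (hSi ((j + 1) ^ 2)).const_mul (1 / ((j : ℝ) + 1) ^ 4)
      exact this.congr (ae_of_all _ fun ω => (hfS j ω).symm)
    have hfm : ∀ j, AEMeasurable (fun ω => ENNReal.ofReal (f j ω)) μ := fun j =>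
      (hfi j).aestronglyMeasurable.aemeasurable.ennreal_ofReal
    have hfle : ∀ j : ℕ, ∫ ω, f j ω ∂μ ≤ c ^ 2 * (1 / ((j + 1 : ℕ) : ℝ) ^ 2) := by
      intro j
      simp_rw [hfS, integral_const_mul]
      have := hvar ((j + 1) ^ 2)
      push_cast at this ⊢
      calc 1 / ((j : ℝ) + 1) ^ 4 * ∫ ω, S ((j + 1) ^ 2) ω ^ 2 ∂μ
          ≤ 1 / ((j : ℝ) + 1) ^ 4 * (((j : ℝ) + 1) ^ 2 * c ^ 2) := by gcongr
        _ = c ^ 2 * (1 / ((j : ℝ) + 1) ^ 2) := by field_simp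
    have hsummable : Summable fun j : ℕ => c ^ 2 * (1 / ((j + 1 : ℕ) : ℝ) ^ 2) :=
      ((summable_nat_add_iff 1).2 (Real.summable_one_div_nat_pow.2 one_lt_two)).mul_left _
    have htsum : ∫⁻ ω, ∑' j, ENNReal.ofReal (f j ω) ∂μ ≠ ⊤ := by
      rw [lintegral_tsum hfm]
      refine ne_top_of_le_ne_top hsummable.tsum_ofReal_ne_top (ENNReal.tsum_le_tsum fun j => ?_)
      rw [← ofReal_integral_eq_lintegral_ofReal (hfi j) (ae_of_all _ fun ω => sq_nonneg _)]
      exact ENNReal.ofReal_le_ofReal (hfle j)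
    filter_upwards [ae_lt_top' (AEMeasurable.tsum hfm) htsum] with ω hω
    have h1 := ENNReal.tendsto_atTop_zero_of_tsum_ne_top hω.ne
    have h2 : Tendsto (fun j => f j ω) atTop (𝓝 0) := by
      have := (ENNReal.tendsto_toReal ENNReal.zero_ne_top).comp h1
      simpa [Function.comp_def, hf, ENNReal.toReal_ofReal, sq_nonneg] using this
    have h3 := h2.sqrt
    simp only [hf, Real.sqrt_sq_eq_abs, Real.sqrt_zero] at h3
    exact (tendsto_zero_iff_abs_tendsto_zero _).2 h3
  filter_upwards [hb', hfin] with ω h h'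
  exact tendsto_avg_zero_of_squares h h'

end StrongLaw

/-! ### Conditional laws of the frames -/

section Disintegration

variable {Ω E 𝓨 : Type*} [MeasurableSpace Ω] [MeasurableSpace E] [MeasurableSpace 𝓨]
  {μ : Measure Ω} [IsProbabilityMeasure μ] {h : Ω → E} {κ : Kernel E 𝓨} [IsMarkovKernel κ]
  {Y : Ω → 𝓨}

/-- A conditional law given on rectangles determines the joint law. -/
lemma map_prodMk_eq_compProd (hh : Measurable h) (hY : Measurable Y)
    (law : ∀ A, MeasurableSet A → ∀ S, MeasurableSet S →
      μ (h ⁻¹' A ∩ Y ⁻¹' S) = ∫⁻ ω in h ⁻¹' A, κ (h ω) S ∂μ) :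
    μ.map (fun ω => (h ω, Y ω)) = (μ.map h) ⊗ₘ κ := by
  have : IsProbabilityMeasure (μ.map h) := Measure.isProbabilityMeasure_map hh.aemeasurable
  have : IsProbabilityMeasure (μ.map fun ω => (h ω, Y ω)) :=
    Measure.isProbabilityMeasure_map (hh.prodMk hY).aemeasurable
  refine Measure.ext_prod fun {A S} hA hS => ?_
  rw [Measure.compProd_apply_prod hA hS, Measure.map_apply (hh.prodMk hY) (hA.prod hS),
    setLIntegral_map hA (κ.measurable_coe hS) hh, ← law A hA S hS]
  rfl

lemma integral_mul_of_conditional_law (hh : Measurable h) (hY : Measurable Y)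
    (law : ∀ A, MeasurableSet A → ∀ S, MeasurableSet S →
      μ (h ⁻¹' A ∩ Y ⁻¹' S) = ∫⁻ ω in h ⁻¹' A, κ (h ω) S ∂μ)
    {φ : E → ℝ} {g : 𝓨 → ℝ} (hφ : Measurable φ) (hg : Measurable g) {C c : ℝ}
    (hφb : ∀ᵐ ω ∂μ, |φ (h ω)| ≤ C) (hgb : ∀ᵐ ω ∂μ, |g (Y ω)| ≤ c) :
    ∫ ω, φ (h ω) * g (Y ω) ∂μ = ∫ ω, φ (h ω) * ∫ y, g y ∂(κ (h ω)) ∂μ := by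
  have hprod := map_prodMk_eq_compProd hh hY law
  have : IsProbabilityMeasure (μ.map h) := Measure.isProbabilityMeasure_map hh.aemeasurable
  have hm : Measurable fun z : E × 𝓨 => φ z.1 * g z.2 :=
    (hφ.comp measurable_fst).mul (hg.comp measurable_snd)
  have hi : Integrable (fun ω => φ (h ω) * g (Y ω)) μ := by
    refine Integrable.of_bound ((hφ.comp hh).mul (hg.comp hY)).aestronglyMeasurable (C * c) ?_
    filter_upwards [hφb, hgb] with ω h1 h2
    rw [Real.norm_eq_abs, abs_mul]
    exact mul_le_mul h1 h2 (abs_nonneg _) ((abs_nonneg _).trans h1)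
  have hi' : Integrable (fun z : E × 𝓨 => φ z.1 * g z.2) ((μ.map h) ⊗ₘ κ) := by
    rw [← hprod]
    exact (integrable_map_measure hm.aestronglyMeasurable (hh.prodMk hY).aemeasurable).2 hi
  have e1 := integral_map (μ := μ) (hh.prodMk hY).aemeasurable
    (f := fun z : E × 𝓨 => φ z.1 * g z.2) hm.aestronglyMeasurable
  rw [hprod, Measure.integral_compProd hi'] at e1
  simp only [integral_const_mul] at e1
  rw [← e1, integral_map hh.aemeasurable]
  exact (hφ.mul (hg.stronglyMeasurable.integral_kernel (κ := κ)).measurable).aestronglyMeasurable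

end Disintegration

namespace AdProcess

variable {N : ℕ} {b : Bounds N} {M : Fin N → Type u}
  [∀ n, TopologicalSpace (M n)] [∀ n, CompactSpace (M n)]
  [∀ n, MeasurableSpace (M n)] [∀ n, BorelSpace (M n)]
  {Ω : Type v} [mΩ : MeasurableSpace Ω]
  {sys : AdSystem b M} {μ : Measure Ω} (X : AdProcess sys μ)

/-- The information available at the beginning of frame `k` of site `n`. -/
abbrev info (n : Fin N) (k : ℕ) : MeasurableSpace Ω := (X.isStoppingTime_start n k).measurableSpace

/-- The action (investment, freeze time, configuration) in frame `k` of site `n`. -/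
def action (n : Fin N) (k : ℕ) (ω : Ω) : ℝ × ℝ × M n := (X.p n k ω, X.fr n k ω, X.m n k ω)

/-- The outcome (depletion time, revenue) of frame `k` of site `n`. -/
def result (n : Fin N) (k : ℕ) (ω : Ω) : ℝ × ℝ := (X.Tad n k ω, X.R n k ω)

lemma frameLen_nonneg (n : Fin N) (k : ℕ) (ω : Ω) : 0 ≤ X.frameLen n k ω :=
  add_nonneg (X.Tad_nonneg n k ω) (sys.P_bounds n _ _ (X.action_mem n k ω)).2.2.1

lemma info_le (n : Fin N) (k : ℕ) : X.info n k ≤ mΩ :=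
  (X.isStoppingTime_start n k).measurableSpace_le

lemma info_mono (n : Fin N) : Monotone (X.info n) := by
  refine monotone_nat_of_le_succ fun k => IsStoppingTime.measurableSpace_mono _ _ fun ω => ?_
  refine WithTop.coe_le_coe.2 ?_
  rw [frameStart, frameStart, Finset.sum_range_succ]
  exact le_add_of_nonneg_right (X.frameLen_nonneg n k ω)

lemma measurable_action (n : Fin N) (k : ℕ) : Measurable[X.info n k] (X.action n k) :=
  (X.p_meas n k).prodMk ((X.fr_meas n k).prodMk (X.m_meas n k))

lemma measurable_result (n : Fin N) (k : ℕ) : Measurable[X.info n (k + 1)] (X.result n k) :=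
  (X.Tad_meas n k).prodMk (X.R_meas n k)

/-- The law of the outcome of a frame as a kernel from pairs of a further number and an action. It
depends on the action only; the number stands for a statistic `Z` of the past, so that joint laws of
`Z`, the action and the outcome can be written on standard product spaces, without reference to the
σ-algebra of the past. -/
def outcomeKernel (sys : AdSystem b M) (n : Fin N) (k : ℕ) : Kernel (ℝ × ℝ × ℝ × M n) (ℝ × ℝ) :=
  (sys.outcome n k).comap (fun e => (e.2.1, e.2.2.2)) (by fun_prop)

instance (n : Fin N) (k : ℕ) : IsMarkovKernel (outcomeKernel sys n k) :=
  have := sys.outcome_markov n k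
  inferInstanceAs (IsMarkovKernel (Kernel.comap _ _ _))

/-- The law of the outcome, conditional on the action and on a statistic `Z` of the past. -/
lemma conditional_law (n : Fin N) (k : ℕ) {Z : Ω → ℝ} (hZ : Measurable[X.info n k] Z)
    (A : Set (ℝ × ℝ × ℝ × M n)) (hA : MeasurableSet A) (S : Set (ℝ × ℝ)) (hS : MeasurableSet S) :
    μ ((fun ω => (Z ω, X.action n k ω)) ⁻¹' A ∩ X.result n k ⁻¹' S)
      = ∫⁻ ω in (fun ω => (Z ω, X.action n k ω)) ⁻¹' A,
          outcomeKernel sys n k (Z ω, X.action n k ω) S ∂μ :=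
  X.outcome_law n k _ ((hZ.prodMk (X.measurable_action n k)) hA) S hS

variable [IsProbabilityMeasure μ]

/-- A property of (action, outcome) that holds almost surely under the prescribed outcome law of
every feasible action holds almost surely in every frame. -/
lemma ae_frame (n : Fin N) (k : ℕ) {D : (ℝ × ℝ × M n) → (ℝ × ℝ) → Prop}
    (hD : MeasurableSet {z : (ℝ × ℝ × M n) × (ℝ × ℝ) | D z.1 z.2})
    (h : ∀ p fr m, (p, fr) ∈ sys.P n → ∀ᵐ x ∂(sys.outcome n k (p, m)), D (p, fr, m) x) :
    ∀ᵐ ω ∂μ, D (X.action n k ω) (X.result n k ω) := by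
  have hZ : Measurable[X.info n k] fun _ : Ω => (0 : ℝ) := measurable_const
  have hact := (X.measurable_action n k).mono (X.info_le n k) le_rfl
  have hh : Measurable fun ω => ((0 : ℝ), X.action n k ω) := measurable_const.prodMk hact
  have hY := (X.measurable_result n k).mono (X.info_le n (k + 1)) le_rfl
  have hprod := map_prodMk_eq_compProd hh hY (X.conditional_law n k hZ)
  have hD' : MeasurableSet {z : (ℝ × ℝ × ℝ × M n) × (ℝ × ℝ) | D z.1.2 z.2} := by
    have : Measurable fun z : (ℝ × ℝ × ℝ × M n) × (ℝ × ℝ) => (z.1.2, z.2) := by fun_prop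
    exact this hD
  have hP : MeasurableSet {e : ℝ × ℝ × ℝ × M n | (e.2.1, e.2.2.1) ∈ sys.P n} := by
    have : Measurable fun e : ℝ × ℝ × ℝ × M n => (e.2.1, e.2.2.1) := by fun_prop
    exact this (sys.P_compact n).measurableSet
  have h1 : ∀ᵐ e ∂(μ.map fun ω => ((0 : ℝ), X.action n k ω)),
      ∀ᵐ x ∂(outcomeKernel sys n k e), D e.2 x := by
    filter_upwards [(ae_map_iff hh.aemeasurable hP).2
      (ae_of_all _ fun ω => X.action_mem n k ω)] with e he
    exact h _ _ _ he
  have h2 := Measure.ae_compProd_of_ae_ae hD' h1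
  rw [← hprod] at h2
  exact (ae_map_iff (hh.prodMk hY).aemeasurable hD').1 h2

lemma ae_frameLen_mem :
    ∀ᵐ ω ∂μ, ∀ n k, b.Tmin n ≤ X.frameLen n k ω ∧ X.frameLen n k ω ≤ b.Tmax n := by
  refine ae_all_iff.2 fun n => ae_all_iff.2 fun k => ?_
  refine X.ae_frame n k (D := fun a x => b.Tmin n ≤ x.1 + a.2.1 ∧ x.1 + a.2.1 ≤ b.Tmax n) ?_ ?_
  · have h1 : Measurable fun z : (ℝ × ℝ × M n) × (ℝ × ℝ) => z.2.1 + z.1.2.1 := by fun_prop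
    exact (measurableSet_le measurable_const h1).inter (measurableSet_le h1 measurable_const)
  · intro p fr m hp
    filter_upwards [sys.time_bounds n k p fr m hp] with x hx using hx.2

/-- Law of large numbers for a site: the differences between a bounded statistic of the outcome of a
frame and its conditional mean average out, also when weighted by a bounded function of the action
of the frame. -/
lemma ae_tendsto_avg_outcome (n : Fin N) {g : ℝ × ℝ → ℝ} (hg : Measurable g) {c : ℝ}
    (hgb : ∀ k p fr m, (p, fr) ∈ sys.P n → ∀ᵐ x ∂(sys.outcome n k (p, m)), |g x| ≤ c)
    {w : ℝ × ℝ × M n → ℝ} (hw : Measurable w) {C : ℝ}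
    (hwb : ∀ p fr m, (p, fr) ∈ sys.P n → |w (p, fr, m)| ≤ C) :
    ∀ᵐ ω ∂μ, Tendsto (avg fun k => w (X.action n k ω) *
      (g (X.result n k ω) - ∫ x, g x ∂(sys.outcome n k (X.p n k ω, X.m n k ω)))) atTop (𝓝 0) := by
  have hresb : ∀ k, ∀ᵐ ω ∂μ, |g (X.result n k ω)| ≤ c := fun k =>
    X.ae_frame n k (D := fun _ x => |g x| ≤ c)
      (measurableSet_le ((hg.comp measurable_snd).abs) measurable_const)
      (fun p fr m hp => hgb k p fr m hp)
  have hmeanb : ∀ k ω, |∫ x, g x ∂(sys.outcome n k (X.p n k ω, X.m n k ω))| ≤ c := by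
    intro k ω
    have := sys.outcome_markov n k
    have h := norm_integral_le_of_norm_le_const (f := g) (C := c)
      (hgb k _ _ (X.m n k ω) (X.action_mem n k ω))
    simpa using h
  have hwX : ∀ k ω, |w (X.action n k ω)| ≤ C := fun k ω => hwb _ _ _ (X.action_mem n k ω)
  have hmeanm : ∀ k, Measurable fun a : ℝ × ℝ × M n => ∫ x, g x ∂(sys.outcome n k (a.1, a.2.2)) :=
    fun k => (hg.stronglyMeasurable.integral_kernel (κ := sys.outcome n k)).measurable.comp
      (by fun_prop : Measurable fun a : ℝ × ℝ × M n => (a.1, a.2.2))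
  refine ae_tendsto_avg_zero (c := C * (c + c)) (X.info_mono n) (X.info_le n) ?_ ?_ ?_
  · intro k
    have hact := (X.measurable_action n k).mono (X.info_mono n k.le_succ) le_rfl
    exact (hw.comp hact).mul ((hg.comp (X.measurable_result n k)).sub ((hmeanm k).comp hact))
  · intro k
    filter_upwards [hresb k] with ω h
    rw [abs_mul]
    exact mul_le_mul (hwX k ω) ((abs_sub _ _).trans (add_le_add h (hmeanb k ω)))
      (abs_nonneg _) ((abs_nonneg _).trans (hwX k ω))
  · rintro k Z hZ ⟨C', hC'⟩
    have hZm := hZ.mono (X.info_le n k) le_rfl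
    have hact := (X.measurable_action n k).mono (X.info_le n k) le_rfl
    have hh : Measurable fun ω => (Z ω, X.action n k ω) := hZm.prodMk hact
    have hY := (X.measurable_result n k).mono (X.info_le n (k + 1)) le_rfl
    have hφ : Measurable fun e : ℝ × ℝ × ℝ × M n => e.1 * w e.2 := by fun_prop
    have hb : ∀ᵐ ω ∂μ, |Z ω * w (X.action n k ω)| ≤ C' * C := by
      filter_upwards [hC'] with ω h
      rw [abs_mul]
      exact mul_le_mul h (hwX k ω) (abs_nonneg _) ((abs_nonneg _).trans h)
    have key := integral_mul_of_conditional_law hh hY (X.conditional_law n k hZ) hφ hg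
      hb (hresb k)
    have hi1 : Integrable (fun ω => Z ω * w (X.action n k ω) * g (X.result n k ω)) μ := by
      refine Integrable.of_bound
        ((hφ.comp hh).mul (hg.comp hY)).aestronglyMeasurable (C' * C * c) ?_
      filter_upwards [hb, hresb k] with ω h1 h2
      rw [Real.norm_eq_abs, abs_mul]
      exact mul_le_mul h1 h2 (abs_nonneg _) ((abs_nonneg _).trans h1)
    have hi2 : Integrable (fun ω => Z ω * w (X.action n k ω) *
        ∫ x, g x ∂(sys.outcome n k (X.p n k ω, X.m n k ω))) μ := by
      refine Integrable.of_bound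
        ((hφ.comp hh).mul ((hmeanm k).comp hact)).aestronglyMeasurable (C' * C * c) ?_
      filter_upwards [hb] with ω h1
      rw [Real.norm_eq_abs, abs_mul]
      exact mul_le_mul h1 (hmeanb k ω) (abs_nonneg _) ((abs_nonneg _).trans h1)
    have hsub := integral_sub hi1 hi2
    calc _ = ∫ ω, (Z ω * w (X.action n k ω) * g (X.result n k ω) - Z ω * w (X.action n k ω) *
          ∫ x, g x ∂(sys.outcome n k (X.p n k ω, X.m n k ω))) ∂μ := by
          congr 1; ext ω; ring
      _ = 0 := by rw [hsub]; exact sub_eq_zero.2 key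

end AdProcess

namespace AdSystem

variable {N : ℕ} {b : Bounds N} {M : Fin N → Type u}
  [∀ n, TopologicalSpace (M n)] [∀ n, CompactSpace (M n)]
  [∀ n, MeasurableSpace (M n)] [∀ n, BorelSpace (M n)] (sys : AdSystem b M)
  {n : Fin N} {p fr : ℝ}

lemma abs_time_le (k : ℕ) (h : (p, fr) ∈ sys.P n) (m : M n) :
    ∀ᵐ x ∂(sys.outcome n k (p, m)), |x.1| ≤ b.Tmax n := by
  filter_upwards [sys.time_bounds n k p fr m h] with x hx
  rw [abs_of_nonneg hx.1]
  linarith [hx.2.2, (sys.P_bounds n p fr h).2.2.1]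

/-- The mean frame length is at least the minimal one. -/
lemma Tmin_le (h : (p, fr) ∈ sys.P n) (m : M n) : b.Tmin n ≤ sys.F n p m + fr := by
  have := sys.outcome_markov n 0
  have hi : Integrable (fun x : ℝ × ℝ => x.1) (sys.outcome n 0 (p, m)) :=
    Integrable.of_bound measurable_fst.aestronglyMeasurable (b.Tmax n) (sys.abs_time_le 0 h m)
  have h1 : ∫ _x, (b.Tmin n - fr) ∂(sys.outcome n 0 (p, m))
      ≤ ∫ x, x.1 ∂(sys.outcome n 0 (p, m)) := by
    refine integral_mono_ae (integrable_const _) hi ?_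
    filter_upwards [sys.time_bounds n 0 p fr m h] with x hx
    have := hx.2.1
    show b.Tmin n - fr ≤ x.1
    linarith
  rw [sys.mean_time n 0 p fr m h] at h1
  simp only [integral_const, probReal_univ, one_smul] at h1
  linarith

lemma Gmax_pos (h : (p, fr) ∈ sys.P n) (m : M n) : 0 < sys.Gmax :=
  (sys.G_nonneg n p fr m h).trans_lt (sys.G_lt n p fr m h)

end AdSystem

namespace AdProcess

variable {N : ℕ} {b : Bounds N} {M : Fin N → Type u}
  [∀ n, TopologicalSpace (M n)] [∀ n, CompactSpace (M n)]
  [∀ n, MeasurableSpace (M n)] [∀ n, BorelSpace (M n)]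
  {Ω : Type v} [mΩ : MeasurableSpace Ω]
  {sys : AdSystem b M} {μ : Measure Ω} [IsProbabilityMeasure μ] (X : AdProcess sys μ)

lemma ae_tendsto_avg_time (n : Fin N) {w : ℝ × ℝ × M n → ℝ} (hw : Measurable w) {C : ℝ}
    (hwb : ∀ p fr m, (p, fr) ∈ sys.P n → |w (p, fr, m)| ≤ C) :
    ∀ᵐ ω ∂μ, Tendsto (avg fun k => w (X.action n k ω) *
      (X.Tad n k ω - sys.F n (X.p n k ω) (X.m n k ω))) atTop (𝓝 0) := by
  filter_upwards [X.ae_tendsto_avg_outcome n measurable_fst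
    (fun k p fr m h => sys.abs_time_le k h m) hw hwb] with ω h
  simp only [fun k => sys.mean_time n k _ _ (X.m n k ω) (X.action_mem n k ω)] at h
  exact h

lemma ae_tendsto_avg_revenue (n : Fin N) :
    ∀ᵐ ω ∂μ, Tendsto (avg fun k => X.R n k ω - sys.G n (X.p n k ω) (X.m n k ω))
      atTop (𝓝 0) := by
  filter_upwards [X.ae_tendsto_avg_outcome n measurable_snd
    (fun k p fr m h => sys.revenue_bound n k p fr m h) (w := fun _ => 1) (C := 1)
    measurable_const (by simp)] with ω h
  simp only [fun k => sys.mean_revenue n k _ _ (X.m n k ω) (X.action_mem n k ω), one_mul] at h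
  exact h

end AdProcess

/-! ### Frames and decision points along a path -/

namespace AdProcess

variable {N : ℕ} {b : Bounds N} {M : Fin N → Type u}
  [∀ n, TopologicalSpace (M n)] [∀ n, CompactSpace (M n)]
  [∀ n, MeasurableSpace (M n)] [∀ n, BorelSpace (M n)]
  {Ω : Type v} [mΩ : MeasurableSpace Ω]
  {sys : AdSystem b M} {μ : Measure Ω} (X : AdProcess sys μ)

/-- All frame lengths along the path `ω` are between their bounds. -/
def IsRegular (ω : Ω) : Prop :=
  ∀ n k, b.Tmin n ≤ X.frameLen n k ω ∧ X.frameLen n k ω ≤ b.Tmax n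

/-- The index of the frame in which site `n` is at the decision point `t d`. -/
def cur (n : Fin N) (d : ℕ) (ω : Ω) : ℕ := X.frameIdx n (X.t d ω) ω

variable {X} {ω : Ω} {n : Fin N}

lemma start_zero : X.start n 0 ω = 0 := by simp [start, frameStart]

lemma start_succ (k : ℕ) : X.start n (k + 1) ω = X.start n k ω + X.frameLen n k ω := by
  simp [start, frameStart, frameLen, Finset.sum_range_succ]

lemma start_eq_sum (k : ℕ) :
    X.start n k ω = ∑ j ∈ Finset.range k, X.frameLen n j ω := rfl

lemma IsRegular.frameLen_pos (h : X.IsRegular ω) (n : Fin N) (k : ℕ) : 0 < X.frameLen n k ω :=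
  (b.Tmin_pos n).trans_le (h n k).1

lemma IsRegular.start_strictMono (h : X.IsRegular ω) (n : Fin N) :
    StrictMono fun k => X.start n k ω := by
  refine strictMono_nat_of_lt_succ fun k => ?_
  rw [start_succ]
  linarith [h.frameLen_pos n k]

lemma IsRegular.mul_Tmin_le_start (h : X.IsRegular ω) (n : Fin N) (k : ℕ) :
    k * b.Tmin n ≤ X.start n k ω := by
  induction k with
  | zero => simp [start_zero]
  | succ k ih => rw [start_succ]; push_cast; linarith [(h n k).1]

lemma IsRegular.start_le_mul_Tmax (h : X.IsRegular ω) (n : Fin N) (k : ℕ) :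
    X.start n k ω ≤ k * b.Tmax n := by
  induction k with
  | zero => simp [start_zero]
  | succ k ih => rw [start_succ]; push_cast; linarith [(h n k).2]

lemma IsRegular.frameIdx_spec (h : X.IsRegular ω) (n : Fin N) {s : ℝ} (hs : 0 ≤ s) :
    X.start n (X.frameIdx n s ω) ω ≤ s ∧ s < X.start n (X.frameIdx n s ω + 1) ω := by
  have hbdd : BddAbove {k | X.start n k ω ≤ s} := by
    refine ⟨⌈s / b.Tmin n⌉₊, fun k hk => ?_⟩
    have h1 : (k : ℝ) ≤ s / b.Tmin n :=
      (le_div_iff₀ (b.Tmin_pos n)).2 ((h.mul_Tmin_le_start n k).trans hk)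
    exact_mod_cast h1.trans (Nat.le_ceil _)
  have hne : {k | X.start n k ω ≤ s}.Nonempty := ⟨0, by simpa [start_zero] using hs⟩
  refine ⟨Nat.sSup_mem hne hbdd, ?_⟩
  by_contra! hcon
  have := le_csSup hbdd hcon
  simp only [frameIdx] at this
  omega

lemma IsRegular.frameIdx_eq (h : X.IsRegular ω) {s : ℝ} {k : ℕ}
    (h1 : X.start n k ω ≤ s) (h2 : s < X.start n (k + 1) ω) : X.frameIdx n s ω = k := by
  have hs : 0 ≤ s := by
    have := (h.start_strictMono n).monotone (Nat.zero_le k)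
    simp only [start_zero] at this
    exact this.trans h1
  obtain ⟨h3, h4⟩ := h.frameIdx_spec n hs
  have h5 := (h.start_strictMono n).lt_iff_lt.1 (h3.trans_lt h2)
  have h6 := (h.start_strictMono n).lt_iff_lt.1 (h1.trans_lt h4)
  omega

lemma sum_δ (D : ℕ) : ∑ d ∈ Finset.range D, X.δ d ω = X.t D ω := by
  simp only [δ]
  rw [Finset.sum_range_sub (fun d => X.t d ω)]
  simp [t]

lemma cur_zero (h : X.IsRegular ω) : X.cur n 0 ω = 0 := by
  refine h.frameIdx_eq (by simp [start_zero, t]) ?_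
  rw [start_succ, start_zero, t, zero_add]
  exact h.frameLen_pos n 0

lemma IsRegular.Tmax_pos (h : X.IsRegular ω) (n : Fin N) : 0 < b.Tmax n :=
  (h.frameLen_pos n 0).trans_le (h n 0).2

lemma IsRegular.lim_frameLen_pos {τ : ℝ} (h : X.IsRegular ω)
    (hτ : Tendsto (avg fun k => X.frameLen n k ω) atTop (𝓝 τ)) : 0 < τ := by
  refine (b.Tmin_pos n).trans_le (ge_of_tendsto hτ ?_)
  filter_upwards [eventually_ge_atTop 1] with K hK
  rw [avg_eq, ← start_eq_sum, le_div_iff₀ (by positivity), mul_comm]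
  exact h.mul_Tmin_le_start n K

variable [NeZero N]

/-- The infimum that defines the next decision point is attained: it is the earliest end of a
running frame. -/
lemma IsRegular.t_succ_aux (h : X.IsRegular ω) {d : ℕ} (h0 : 0 ≤ X.t d ω) :
    IsLeast {s | X.t d ω < s ∧ ∃ n k, s = X.start n k ω} (X.t (d + 1) ω) ∧
      ∀ n, X.t (d + 1) ω ≤ X.start n (X.cur n d ω + 1) ω := by
  obtain ⟨n₀, hn₀⟩ := Finite.exists_min fun n => X.start n (X.cur n d ω + 1) ω
  have hleast : IsLeast {s | X.t d ω < s ∧ ∃ n k, s = X.start n k ω}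
      (X.start n₀ (X.cur n₀ d ω + 1) ω) := by
    refine ⟨⟨(h.frameIdx_spec n₀ h0).2, n₀, _, rfl⟩, ?_⟩
    rintro s ⟨hs, n, k, rfl⟩
    have hk : X.cur n d ω < k :=
      (h.start_strictMono n).lt_iff_lt.1 ((h.frameIdx_spec n h0).1.trans_lt hs)
    exact (hn₀ n).trans ((h.start_strictMono n).monotone hk)
  have heq : X.t (d + 1) ω = X.start n₀ (X.cur n₀ d ω + 1) ω := hleast.csInf_eq
  exact ⟨heq ▸ hleast, fun n => heq ▸ hn₀ n⟩

lemma IsRegular.t_nonneg (h : X.IsRegular ω) (d : ℕ) : 0 ≤ X.t d ω := by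
  induction d with
  | zero => exact le_rfl
  | succ d ih => exact ih.trans (h.t_succ_aux ih).1.1.1.le

lemma IsRegular.t_lt_succ (h : X.IsRegular ω) (d : ℕ) : X.t d ω < X.t (d + 1) ω :=
  (h.t_succ_aux (h.t_nonneg d)).1.1.1

lemma IsRegular.t_pos (h : X.IsRegular ω) {d : ℕ} (hd : 1 ≤ d) : 0 < X.t d ω := by
  obtain ⟨e, rfl⟩ := Nat.exists_eq_add_of_le' hd
  exact (h.t_nonneg e).trans_lt (h.t_lt_succ e)

lemma IsRegular.δ_pos (h : X.IsRegular ω) (d : ℕ) : 0 < X.δ d ω := sub_pos.2 (h.t_lt_succ d)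

lemma IsRegular.t_succ_le (h : X.IsRegular ω) (n : Fin N) (d : ℕ) :
    X.t (d + 1) ω ≤ X.start n (X.cur n d ω + 1) ω := (h.t_succ_aux (h.t_nonneg d)).2 n

lemma IsRegular.exists_t_succ_eq (h : X.IsRegular ω) (d : ℕ) :
    ∃ n k, X.t (d + 1) ω = X.start n k ω := (h.t_succ_aux (h.t_nonneg d)).1.1.2

lemma IsRegular.start_cur_le (h : X.IsRegular ω) (n : Fin N) (d : ℕ) :
    X.start n (X.cur n d ω) ω ≤ X.t d ω := (h.frameIdx_spec n (h.t_nonneg d)).1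

lemma IsRegular.lt_start_cur (h : X.IsRegular ω) (n : Fin N) (d : ℕ) :
    X.t d ω < X.start n (X.cur n d ω + 1) ω := (h.frameIdx_spec n (h.t_nonneg d)).2

/-- From one decision point to the next a site either stays in its frame or moves to the next one,
which then starts at the new decision point. -/
lemma IsRegular.cur_succ (h : X.IsRegular ω) (n : Fin N) (d : ℕ) :
    (X.cur n (d + 1) ω = X.cur n d ω ∧ X.t (d + 1) ω < X.start n (X.cur n d ω + 1) ω) ∨
    (X.cur n (d + 1) ω = X.cur n d ω + 1 ∧ X.t (d + 1) ω = X.start n (X.cur n d ω + 1) ω) := by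
  rcases (h.t_succ_le n d).lt_or_eq with hlt | heq
  · exact Or.inl ⟨h.frameIdx_eq ((h.start_cur_le n d).trans (h.t_lt_succ d).le) hlt, hlt⟩
  · refine Or.inr ⟨h.frameIdx_eq heq.ge ?_, heq⟩
    rw [heq]
    exact h.start_strictMono n (Nat.lt_succ_self _)

lemma IsRegular.starts_of_cur_succ (h : X.IsRegular ω) {d : ℕ}
    (hd : X.cur n (d + 1) ω = X.cur n d ω + 1) : X.Starts n (d + 1) ω := by
  rcases h.cur_succ n d with h1 | h1
  · omega
  · exact ⟨_, h1.2.symm⟩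

/-- A time integral of a function of the current frame of a site is a sum over its complete frames
and the running frame. -/
lemma IsRegular.sum_δ_mul (h : X.IsRegular ω) (n : Fin N) (f : ℕ → ℝ) (D : ℕ) :
    ∑ d ∈ Finset.range D, X.δ d ω * f (X.cur n d ω)
      = ∑ k ∈ Finset.range (X.cur n D ω), X.frameLen n k ω * f k
        + (X.t D ω - X.start n (X.cur n D ω) ω) * f (X.cur n D ω) := by
  induction D with
  | zero => simp [cur_zero h, start_zero, t]
  | succ D ih =>
    rw [Finset.sum_range_succ, ih]
    rcases h.cur_succ n D with ⟨h1, -⟩ | ⟨h1, h2⟩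
    · rw [h1, δ]; ring
    · rw [h1, Finset.sum_range_succ, δ, h2, start_succ]; ring

/-- At every decision point some site moves to its next frame; hence the decision points do not
accumulate. -/
lemma IsRegular.le_sum_cur (h : X.IsRegular ω) (D : ℕ) : D ≤ ∑ n, X.cur n D ω := by
  induction D with
  | zero => exact Nat.zero_le _
  | succ D ih =>
    refine Nat.succ_le_of_lt (ih.trans_lt (Finset.sum_lt_sum (fun n _ => ?_) ?_))
    · rcases h.cur_succ n D with h1 | h1 <;> omega
    · obtain ⟨n, k, hk⟩ := h.exists_t_succ_eq D
      refine ⟨n, Finset.mem_univ n, ?_⟩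
      have h1 : X.cur n D ω < k := (h.start_strictMono n).lt_iff_lt.1
        ((h.start_cur_le n D).trans_lt ((h.t_lt_succ D).trans_le hk.le))
      have h2 : k < X.cur n (D + 1) ω + 1 := (h.start_strictMono n).lt_iff_lt.1
        (hk.ge.trans_lt (h.lt_start_cur n (D + 1)))
      omega

lemma IsRegular.tendsto_t (h : X.IsRegular ω) : Tendsto (fun D => X.t D ω) atTop atTop := by
  set c : ℝ := ∑ n, 1 / b.Tmin n with hc
  have hcpos : 0 < c :=
    Finset.sum_pos (fun n _ => one_div_pos.2 (b.Tmin_pos n)) Finset.univ_nonempty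
  refine tendsto_atTop_mono (fun D => ?_)
    (tendsto_natCast_atTop_atTop.atTop_div_const hcpos (f := fun D : ℕ => (D : ℝ)))
  rw [div_le_iff₀ hcpos, hc, Finset.mul_sum]
  calc (D : ℝ) ≤ ∑ n, (X.cur n D ω : ℝ) := by exact_mod_cast h.le_sum_cur D
    _ ≤ ∑ n, X.t D ω * (1 / b.Tmin n) := by
      refine Finset.sum_le_sum fun n _ => ?_
      rw [mul_one_div, le_div_iff₀ (b.Tmin_pos n)]
      exact (h.mul_Tmin_le_start n _).trans (h.start_cur_le n D)

lemma IsRegular.tendsto_cur (h : X.IsRegular ω) (n : Fin N) :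
    Tendsto (fun D => X.cur n D ω) atTop atTop := by
  have h1 : Tendsto (fun D => X.t D ω / b.Tmax n - 1) atTop atTop :=
    tendsto_atTop_add_const_right _ _ (h.tendsto_t.atTop_div_const (h.Tmax_pos n))
  refine tendsto_natCast_atTop_iff.1 (tendsto_atTop_mono (fun D => ?_) h1)
  rw [sub_le_iff_le_add, div_le_iff₀ (h.Tmax_pos n)]
  have := (h.lt_start_cur n D).le.trans (h.start_le_mul_Tmax n _)
  push_cast at this
  exact this

lemma IsRegular.t_sub_start_le (h : X.IsRegular ω) (n : Fin N) (d : ℕ) :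
    X.t d ω - X.start n (X.cur n d ω) ω ≤ b.Tmax n := by
  have := h.lt_start_cur n d
  rw [start_succ] at this
  linarith [(h n (X.cur n d ω)).2]

lemma IsRegular.δ_le (h : X.IsRegular ω) (n : Fin N) (d : ℕ) : X.δ d ω ≤ b.Tmax n := by
  have h1 := h.t_succ_le n d
  have h2 := h.start_cur_le n d
  rw [start_succ] at h1
  rw [δ]
  linarith [(h n (X.cur n d ω)).2]

variable {τ : ℝ}

/-- The number of frames per unit of time. -/
lemma IsRegular.tendsto_cur_div_t (h : X.IsRegular ω)
    (hτ : Tendsto (avg fun k => X.frameLen n k ω) atTop (𝓝 τ)) :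
    Tendsto (fun D => (X.cur n D ω : ℝ) / X.t D ω) atTop (𝓝 (1 / τ)) := by
  have hcur : Tendsto (fun D => (X.cur n D ω : ℝ)) atTop atTop :=
    tendsto_natCast_atTop_atTop.comp (h.tendsto_cur n)
  have h1 : Tendsto (fun D => X.t D ω / X.cur n D ω) atTop (𝓝 τ) := by
    have h2 : Tendsto (fun D => (X.t D ω - X.start n (X.cur n D ω) ω) / X.cur n D ω)
        atTop (𝓝 0) := by
      refine squeeze_zero (fun D => ?_) (fun D => ?_)
        (hcur.const_div_atTop (b.Tmax n))
      · exact div_nonneg (sub_nonneg.2 (h.start_cur_le n D)) (Nat.cast_nonneg _)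
      · exact div_le_div_of_nonneg_right (h.t_sub_start_le n D) (Nat.cast_nonneg _)
    have h3 := (hτ.comp (h.tendsto_cur n)).add h2
    rw [add_zero] at h3
    refine h3.congr fun D => ?_
    simp only [Function.comp, avg_eq]
    rw [← start_eq_sum]
    ring
  have h4 := h1.inv₀ (h.lim_frameLen_pos hτ).ne'
  simpa [inv_div] using h4

/-- An upper bound for the long run time average of a bounded function `f` of the current frame of
a site: if `f` times the frame length is at most `w` up to terms which average out, then the time
average of `f` is asymptotically at most the average of `w` per frame divided by the average
frame length. -/
lemma IsRegular.exists_time_avg_le (h : X.IsRegular ω)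
    (hτ : Tendsto (avg fun k => X.frameLen n k ω) atTop (𝓝 τ)) {f w e : ℕ → ℝ} {c l : ℝ}
    (hf : ∀ k, |f k| ≤ c) (hw : Tendsto (avg w) atTop (𝓝 l)) (he : Tendsto (avg e) atTop (𝓝 0))
    (hle : ∀ k, X.frameLen n k ω * f k ≤ w k + e k) :
    ∃ r : ℕ → ℝ, Tendsto r atTop (𝓝 (l / τ)) ∧ ∀ D, 1 ≤ D →
      (∑ d ∈ Finset.range D, X.δ d ω * f (X.cur n d ω)) / X.t D ω ≤ r D := by
  refine ⟨fun D => (X.cur n D ω : ℝ) / X.t D ω * (avg w (X.cur n D ω) + avg e (X.cur n D ω))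
    + b.Tmax n * c / X.t D ω, ?_, fun D hD => ?_⟩
  · have h1 := ((h.tendsto_cur_div_t hτ).mul
      ((hw.comp (h.tendsto_cur n)).add (he.comp (h.tendsto_cur n)))).add
      (h.tendsto_t.const_div_atTop (b.Tmax n * c))
    have e1 : 1 / τ * (l + 0) + 0 = l / τ := by ring
    rw [e1] at h1
    exact h1
  · have ht := h.t_pos hD
    rw [h.sum_δ_mul n f D]
    have h1 : ∑ k ∈ Finset.range (X.cur n D ω), X.frameLen n k ω * f k
        ≤ X.cur n D ω * (avg w (X.cur n D ω) + avg e (X.cur n D ω)) := by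
      rcases Nat.eq_zero_or_pos (X.cur n D ω) with h0 | h0
      · simp [h0]
      · have h0' : (0 : ℝ) < X.cur n D ω := by exact_mod_cast h0
        rw [avg_eq, avg_eq, ← add_div, mul_div_cancel₀ _ h0'.ne', ← Finset.sum_add_distrib]
        exact Finset.sum_le_sum fun k _ => hle k
    have h2 : (X.t D ω - X.start n (X.cur n D ω) ω) * f (X.cur n D ω) ≤ b.Tmax n * c :=
      (mul_le_mul_of_nonneg_left ((le_abs_self _).trans (hf _))
        (sub_nonneg.2 (h.start_cur_le n D))).trans
        (mul_le_mul_of_nonneg_right (h.t_sub_start_le n D) ((abs_nonneg _).trans (hf 0)))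
    show _ ≤ (X.cur n D ω : ℝ) / X.t D ω * (avg w (X.cur n D ω) + avg e (X.cur n D ω))
      + b.Tmax n * c / X.t D ω
    rw [div_mul_eq_mul_div, ← add_div]
    exact div_le_div_of_nonneg_right (add_le_add h1 h2) ht.le

end AdProcess

/-! ### Weak duality for the optimal profit -/

section Averages

lemma avg_sub (x y : ℕ → ℝ) (K : ℕ) : avg (fun k => x k - y k) K = avg x K - avg y K := by
  simp only [avg, Finset.sum_sub_distrib, mul_sub]

lemma avg_const_mul (c : ℝ) (x : ℕ → ℝ) (K : ℕ) : avg (fun k => c * x k) K = c * avg x K := by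
  simp only [avg, ← Finset.mul_sum]
  ring

lemma avg_mono {x y : ℕ → ℝ} (h : ∀ k, x k ≤ y k) (K : ℕ) : avg x K ≤ avg y K := by
  simp only [avg]
  exact mul_le_mul_of_nonneg_left (Finset.sum_le_sum fun k _ => h k) (by positivity)

end Averages

section Duality

variable {N : ℕ} {b : Bounds N} {M : Fin N → Type u}
  [∀ n, TopologicalSpace (M n)] [∀ n, CompactSpace (M n)]
  [∀ n, MeasurableSpace (M n)] [∀ n, BorelSpace (M n)]
  {sys : AdSystem b M} {lam : ℝ} {c : Fin N → ℝ}

/-- For a price `lam` of investments, if no action at site `n` has a mean net revenue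
`G - lam * p` above `c n` per unit of mean frame length, then no strategy has an average net
revenue above `∑ n, c n`. -/
lemma AdProcess.ae_profit_sub_le {Ω : Type v} [MeasurableSpace Ω] {μ : Measure Ω}
    [IsProbabilityMeasure μ] (X : AdProcess sys μ) (hX : X.HasTimeAverages)
    (hc : ∀ n p fr m, (p, fr) ∈ sys.P n → sys.G n p m - lam * p ≤ c n * (sys.F n p m + fr)) :
    ∀ᵐ ω ∂μ, X.profit ω - lam * X.expenditure ω ≤ ∑ n, c n := by
  filter_upwards [X.ae_frameLen_mem, hX, ae_all_iff.2 X.ae_tendsto_avg_revenue,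
    ae_all_iff.2 fun n => X.ae_tendsto_avg_time n (w := fun _ => 1) (C := 1) measurable_const
      (by simp)] with ω hreg hlim hrev htime
  have hreg : X.IsRegular ω := hreg
  rw [AdProcess.profit, AdProcess.expenditure, Finset.mul_sum, ← Finset.sum_sub_distrib]
  refine Finset.sum_le_sum fun n _ => ?_
  obtain ⟨⟨r, hr⟩, ⟨q, hq⟩, ⟨τ, hτ⟩⟩ := hlim n
  have hτpos := hreg.lim_frameLen_pos hτ
  rw [hr.limUnder_eq, hq.limUnder_eq, hτ.limUnder_eq]
  have h1 := le_of_tendsto_of_tendsto' ((hr.sub (hq.const_mul lam)).sub (hrev n))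
    ((hτ.sub (htime n)).const_mul (c n)) fun K => by
      rw [← avg_const_mul, ← avg_sub, ← avg_sub, ← avg_sub, ← avg_const_mul]
      refine avg_mono (fun k => ?_) K
      have := hc n _ _ (X.m n k ω) (X.action_mem n k ω)
      simp only [AdProcess.frameLen, one_mul]
      nlinarith
  rw [← mul_div_assoc, ← sub_div, div_le_iff₀ hτpos]
  simpa using h1

/-- Weak duality: every price of investments yields an upper bound for the optimal profit. -/
lemma AdSystem.optProfit_le {B : ℝ} (hB : 0 ≤ B) (hlam : 0 ≤ lam) (hc0 : ∀ n, 0 ≤ c n)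
    (hc : ∀ n p fr m, (p, fr) ∈ sys.P n → sys.G n p m - lam * p ≤ c n * (sys.F n p m + fr)) :
    sys.optProfit B ≤ lam * B + ∑ n, c n := by
  have h0 : 0 ≤ lam * B + ∑ n, c n :=
    add_nonneg (mul_nonneg hlam hB) (Finset.sum_nonneg fun n _ => hc0 n)
  -- The bound is nonnegative, so it also covers the value `0` of a supremum over the empty set
  -- and of the integral of a function that is not integrable.
  refine Real.sSup_le ?_ h0
  rintro x ⟨Ω, _, μ, _, X, ⟨hX, hcost⟩, rfl⟩
  by_cases hi : Integrable X.profit μ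
  · calc ∫ ω, X.profit ω ∂μ ≤ ∫ _ω, (lam * B + ∑ n, c n) ∂μ := by
          refine integral_mono_ae hi (integrable_const _) ?_
          filter_upwards [hcost, X.ae_profit_sub_le hX hc] with ω h1 h2
          have := mul_le_mul_of_nonneg_left h1 hlam
          show X.profit ω ≤ _
          linarith
      _ = _ := by simp
  · rw [show ∫ ω, X.profit ω ∂μ = 0 from integral_undef hi]
    exact h0

end Duality

/-! ### Estimates -/

namespace AdSystem.EstimationQuality

variable {N : ℕ} {b : Bounds N} {M : Fin N → Type u}
  [∀ n, TopologicalSpace (M n)] [∀ n, CompactSpace (M n)]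
  [∀ n, MeasurableSpace (M n)] [∀ n, BorelSpace (M n)]
  {sys : AdSystem b M} {Gh Fh : (n : Fin N) → ℝ → M n → ℝ} {ρG ρF : ℝ}
  {n : Fin N} {p fr : ℝ}

lemma le_len (hq : sys.EstimationQuality Gh Fh ρG ρF) (hF : 0 ≤ ρF)
    (h : (p, fr) ∈ sys.P n) (m : M n) :
    (1 - ρF) * (sys.F n p m + fr) ≤ Fh n p m + fr := by
  have h1 := (abs_le.1 (hq.Fh_err n p fr m h)).1
  have h2 := mul_nonneg hF (sys.P_bounds n p fr h).2.2.1
  linarith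

lemma len_le (hq : sys.EstimationQuality Gh Fh ρG ρF) (hF : 0 ≤ ρF)
    (h : (p, fr) ∈ sys.P n) (m : M n) :
    Fh n p m + fr ≤ (1 + ρF) * (sys.F n p m + fr) := by
  have h1 := (abs_le.1 (hq.Fh_err n p fr m h)).2
  have h2 := mul_nonneg hF (sys.P_bounds n p fr h).2.2.1
  linarith

lemma Tmin_le_len (hq : sys.EstimationQuality Gh Fh ρG ρF) (hF : 0 ≤ ρF) (hF1 : ρF < 1)
    (h : (p, fr) ∈ sys.P n) (m : M n) : (1 - ρF) * b.Tmin n ≤ Fh n p m + fr :=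
  (mul_le_mul_of_nonneg_left (sys.Tmin_le h m) (sub_nonneg.2 hF1.le)).trans (hq.le_len hF h m)

lemma len_pos (hq : sys.EstimationQuality Gh Fh ρG ρF) (hF : 0 ≤ ρF) (hF1 : ρF < 1)
    (h : (p, fr) ∈ sys.P n) (m : M n) : 0 < Fh n p m + fr :=
  (mul_pos (sub_pos.2 hF1) (b.Tmin_pos n)).trans_le (hq.Tmin_le_len hF hF1 h m)

lemma Gh_le (hq : sys.EstimationQuality Gh Fh ρG ρF) (h : (p, fr) ∈ sys.P n) (m : M n) :
    Gh n p m ≤ (1 + ρG) * sys.G n p m := by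
  linarith [(abs_le.1 (hq.Gh_err n p fr m h)).2]

lemma le_Gh (hq : sys.EstimationQuality Gh Fh ρG ρF) (h : (p, fr) ∈ sys.P n) (m : M n) :
    (1 - ρG) * sys.G n p m ≤ Gh n p m := by
  linarith [(abs_le.1 (hq.Gh_err n p fr m h)).1]

lemma Gh_zero (hq : sys.EstimationQuality Gh Fh ρG ρF) (h : (0, fr) ∈ sys.P n) (m : M n) :
    Gh n 0 m = 0 := by
  have h1 := hq.Gh_le h m
  have h2 := hq.le_Gh h m
  rw [sys.G_zero, mul_zero] at h1 h2
  exact le_antisymm h1 h2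

lemma abs_Gh_le (hq : sys.EstimationQuality Gh Fh ρG ρF) (hG : 0 ≤ ρG) (hG1 : ρG < 1)
    (h : (p, fr) ∈ sys.P n) (m : M n) : |Gh n p m| ≤ (1 + ρG) * sys.Gmax := by
  rw [abs_of_nonneg ((mul_nonneg (by linarith) (sys.G_nonneg n p fr m h)).trans (hq.le_Gh h m))]
  exact (hq.Gh_le h m).trans
    (mul_le_mul_of_nonneg_left (sys.G_lt n p fr m h).le (by linarith))

lemma spend_mem (hq : sys.EstimationQuality Gh Fh ρG ρF) (hF : 0 ≤ ρF) (hF1 : ρF < 1)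
    (h : (p, fr) ∈ sys.P n) (m : M n) :
    0 ≤ p / (Fh n p m + fr) ∧ p / (Fh n p m + fr) ≤ b.pmax n / ((1 - ρF) * b.Tmin n) := by
  obtain ⟨h0, h1, -, -⟩ := sys.P_bounds n p fr h
  exact ⟨div_nonneg h0 (hq.len_pos hF hF1 h m).le,
    div_le_div₀ (h0.trans h1) h1 (mul_pos (sub_pos.2 hF1) (b.Tmin_pos n))
      (hq.Tmin_le_len hF hF1 h m)⟩

lemma abs_gain_le (hq : sys.EstimationQuality Gh Fh ρG ρF) (hG : 0 ≤ ρG) (hG1 : ρG < 1)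
    (hF : 0 ≤ ρF) (hF1 : ρF < 1) (h : (p, fr) ∈ sys.P n) (m : M n) :
    |Gh n p m / (Fh n p m + fr)| ≤ (1 + ρG) * sys.Gmax / ((1 - ρF) * b.Tmin n) := by
  rw [abs_div, abs_of_pos (hq.len_pos hF hF1 h m)]
  exact div_le_div₀ (mul_nonneg (by linarith) (sys.Gmax_pos h m).le)
    (hq.abs_Gh_le hG hG1 h m) (mul_pos (sub_pos.2 hF1) (b.Tmin_pos n))
    (hq.Tmin_le_len hF hF1 h m)

end AdSystem.EstimationQuality

namespace Bounds

variable {N : ℕ} (b : Bounds N)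

/-- The largest possible estimated total consumption rate of the budget. -/
def rateMax (ρF : ℝ) : ℝ := ∑ n, b.pmax n / ((1 - ρF) * b.Tmin n)

/-- The loss, in units of `1 / V`, that is due to the drift of the squared queue and to the
difference between the queue at a decision point and at the beginnings of the running frames. -/
def defect (B ρF : ℝ) : ℝ :=
  b.TmaxAll * (B ^ 2 + b.rateMax ρF ^ 2) / 2
    + b.TmaxAll * (B + b.rateMax ρF) * b.rateMax ρF

lemma Tmax_le_TmaxAll (n : Fin N) : b.Tmax n ≤ b.TmaxAll :=
  le_ciSup (Set.finite_range b.Tmax).bddAbove n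

lemma TminAll_le_Tmin (n : Fin N) : b.TminAll ≤ b.Tmin n :=
  ciInf_le (Set.finite_range b.Tmin).bddBelow n

lemma TminAll_pos [NeZero N] : 0 < b.TminAll := by
  obtain ⟨n, hn⟩ := exists_eq_ciInf_of_finite (f := b.Tmin)
  rw [TminAll, ← hn]
  exact b.Tmin_pos n

end Bounds

/-! ### The deficit queue -/

namespace AdProcess

variable {N : ℕ} {b : Bounds N} {M : Fin N → Type u}
  [∀ n, TopologicalSpace (M n)] [∀ n, CompactSpace (M n)]
  [∀ n, MeasurableSpace (M n)] [∀ n, BorelSpace (M n)]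
  {Ω : Type v} [mΩ : MeasurableSpace Ω]
  {sys : AdSystem b M} {μ : Measure Ω} (X : AdProcess sys μ)

/-- Investment per estimated mean frame length in frame `k` of site `n`. -/
def spend (Fh : (n : Fin N) → ℝ → M n → ℝ) (n : Fin N) (k : ℕ) (ω : Ω) : ℝ :=
  X.p n k ω / (Fh n (X.p n k ω) (X.m n k ω) + X.fr n k ω)

/-- Estimated mean revenue per estimated mean frame length in frame `k` of site `n`. -/
def gain (Gh Fh : (n : Fin N) → ℝ → M n → ℝ) (n : Fin N) (k : ℕ) (ω : Ω) : ℝ :=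
  Gh n (X.p n k ω) (X.m n k ω) / (Fh n (X.p n k ω) (X.m n k ω) + X.fr n k ω)

/-- The decision rule of the Ad-Investment algorithm along the path `ω`. -/
def Optimizes (Gh Fh : (n : Fin N) → ℝ → M n → ℝ) (B V : ℝ) (ω : Ω) : Prop :=
  ∀ d n, X.Starts n d ω → ∀ p fr m, (p, fr) ∈ sys.P n →
    V * (Gh n p m / (Fh n p m + fr)) - X.Q Fh B d ω * (p / (Fh n p m + fr))
      ≤ V * X.gain Gh Fh n (X.cur n d ω) ω - X.Q Fh B d ω * X.spend Fh n (X.cur n d ω) ω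

lemma IsAdInvestment.ae_optimizes {X : AdProcess sys μ} {Gh Fh : (n : Fin N) → ℝ → M n → ℝ}
    {B V : ℝ} (h : X.IsAdInvestment Gh Fh B V) : ∀ᵐ ω ∂μ, X.Optimizes Gh Fh B V ω := by
  filter_upwards [h] with ω hω d n hs p fr m hp
  have := hω d n hs p fr m hp
  simp only [sub_div, mul_div_assoc] at this
  exact this

variable {X} {Gh Fh : (n : Fin N) → ℝ → M n → ℝ} {ρG ρF B V : ℝ} {ω : Ω}

lemma spend_mem (hq : sys.EstimationQuality Gh Fh ρG ρF) (hF : 0 ≤ ρF) (hF1 : ρF < 1)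
    (n : Fin N) (k : ℕ) :
    0 ≤ X.spend Fh n k ω ∧ X.spend Fh n k ω ≤ b.pmax n / ((1 - ρF) * b.Tmin n) :=
  hq.spend_mem hF hF1 (X.action_mem n k ω) _

lemma rate_mem (hq : sys.EstimationQuality Gh Fh ρG ρF) (hF : 0 ≤ ρF) (hF1 : ρF < 1)
    (n : Fin N) (d : ℕ) :
    0 ≤ X.rate Fh n d ω ∧ X.rate Fh n d ω ≤ b.pmax n / ((1 - ρF) * b.Tmin n) :=
  X.spend_mem hq hF hF1 n (X.cur n d ω)

lemma sum_rate_mem (hq : sys.EstimationQuality Gh Fh ρG ρF) (hF : 0 ≤ ρF) (hF1 : ρF < 1)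
    (d : ℕ) :
    0 ≤ ∑ n, X.rate Fh n d ω ∧ ∑ n, X.rate Fh n d ω ≤ b.rateMax ρF :=
  ⟨Finset.sum_nonneg fun n _ => (rate_mem hq hF hF1 n d).1,
    Finset.sum_le_sum fun n _ => (rate_mem hq hF hF1 n d).2⟩

lemma rateMax_nonneg (X : AdProcess sys μ) (ω : Ω) (hq : sys.EstimationQuality Gh Fh ρG ρF)
    (hF : 0 ≤ ρF) (hF1 : ρF < 1) :
    0 ≤ b.rateMax ρF :=
  (sum_rate_mem (X := X) (ω := ω) hq hF hF1 0).1.trans (sum_rate_mem hq hF hF1 0).2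

lemma le_Q_succ (d : ℕ) :
    X.Q Fh B d ω - X.δ d ω * B + X.δ d ω * ∑ n, X.rate Fh n d ω ≤ X.Q Fh B (d + 1) ω := by
  rw [Q]
  gcongr
  exact le_max_left _ _

/-- When the deficit exceeds the maximal return per investment, nothing is invested. -/
lemma Optimizes.p_eq_zero (hopt : X.Optimizes Gh Fh B V ω)
    (hq : sys.EstimationQuality Gh Fh ρG ρF) (hG : 0 ≤ ρG) (hF : 0 ≤ ρF) (hF1 : ρF < 1)
    (hV : 0 ≤ V) {n : Fin N} {d : ℕ} (hs : X.Starts n d ω)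
    (hQ : V * (1 + ρG) * sys.ν < X.Q Fh B d ω) : X.p n (X.cur n d ω) ω = 0 := by
  set k := X.cur n d ω with hk
  have hmem := X.action_mem n k ω
  have hp0 : 0 ≤ X.p n k ω := (sys.P_bounds n _ _ hmem).1
  by_contra hne
  have hp : 0 < X.p n k ω := lt_of_le_of_ne hp0 (Ne.symm hne)
  obtain ⟨fr, hfr⟩ := sys.P_zero n
  have h1 := hopt d n hs 0 fr (X.m n k ω) hfr
  rw [hq.Gh_zero hfr, zero_div, mul_zero, mul_zero, sub_zero, ← hk, gain, spend,
    ← mul_div_assoc, ← mul_div_assoc, ← sub_div] at h1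
  have hD := hq.len_pos hF hF1 hmem (X.m n k ω)
  have h2 : 0 ≤ V * Gh n (X.p n k ω) (X.m n k ω) - X.Q Fh B d ω * X.p n k ω := by
    by_contra! hcon
    exact absurd h1 (not_le.2 (div_neg_of_neg_of_pos hcon hD))
  have h3 : V * Gh n (X.p n k ω) (X.m n k ω) ≤ V * ((1 + ρG) * (sys.ν * X.p n k ω)) := by
    gcongr
    exact (hq.Gh_le hmem _).trans
      (mul_le_mul_of_nonneg_left (sys.G_le n _ _ _ hmem) (by linarith))
  nlinarith

variable [NeZero N]

lemma IsRegular.δ_le_TmaxAll (h : X.IsRegular ω) (d : ℕ) : X.δ d ω ≤ b.TmaxAll :=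
  (h.δ_le 0 d).trans (b.Tmax_le_TmaxAll 0)

lemma IsRegular.TmaxAll_pos (h : X.IsRegular ω) : 0 < b.TmaxAll :=
  (h.δ_pos 0).trans_le (h.δ_le_TmaxAll 0)

lemma IsRegular.Q_nonneg (h : X.IsRegular ω) (hq : sys.EstimationQuality Gh Fh ρG ρF)
    (hF : 0 ≤ ρF) (hF1 : ρF < 1) (d : ℕ) : 0 ≤ X.Q Fh B d ω := by
  cases d with
  | zero => exact le_rfl
  | succ d =>
    exact add_nonneg (le_max_right _ _)
      (mul_nonneg (h.δ_pos d).le (sum_rate_mem hq hF hF1 d).1)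

lemma IsRegular.Q_succ_le (h : X.IsRegular ω) (hq : sys.EstimationQuality Gh Fh ρG ρF)
    (hF : 0 ≤ ρF) (hF1 : ρF < 1) (hB : 0 ≤ B) (d : ℕ) :
    X.Q Fh B (d + 1) ω ≤ X.Q Fh B d ω + X.δ d ω * ∑ n, X.rate Fh n d ω := by
  rw [Q]
  gcongr
  exact max_le (sub_le_self _ (mul_nonneg (h.δ_pos d).le hB)) (h.Q_nonneg hq hF hF1 d)

/-- The queue is bounded. Once it exceeds `V * (1 + ρG) * ν`, only the running frames still
contribute to it. Accordingly the queue plus the future contribution of the running frames cannot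
increase while the queue is above this level. -/
lemma IsRegular.Q_le (h : X.IsRegular ω) (hopt : X.Optimizes Gh Fh B V ω)
    (hq : sys.EstimationQuality Gh Fh ρG ρF) (hG : 0 ≤ ρG) (hF : 0 ≤ ρF) (hF1 : ρF < 1)
    (hB : 0 ≤ B) (hV : 0 ≤ V) (d : ℕ) :
    X.Q Fh B d ω ≤ V * (1 + ρG) * sys.ν + b.rateMax ρF * b.TmaxAll := by
  have hres : ∀ n d, 0 ≤ X.start n (X.cur n d ω + 1) ω - X.t d ω := fun n d =>
    sub_nonneg.2 (h.lt_start_cur n d).le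
  have hresle : ∀ n d, X.start n (X.cur n d ω + 1) ω - X.t d ω ≤ b.TmaxAll := fun n d => by
    have h1 := h.start_cur_le n d
    rw [start_succ]
    linarith [(h n (X.cur n d ω)).2, b.Tmax_le_TmaxAll n]
  have hsmall : ∀ d, ∑ n, X.rate Fh n d ω * (X.start n (X.cur n d ω + 1) ω - X.t d ω)
      ≤ b.rateMax ρF * b.TmaxAll := fun d => by
    rw [Bounds.rateMax, Finset.sum_mul]
    exact Finset.sum_le_sum fun n _ => mul_le_mul (rate_mem hq hF hF1 n d).2 (hresle n d)
      (hres n d) ((rate_mem (X := X) (ω := ω) hq hF hF1 n d).1.trans (rate_mem hq hF hF1 n d).2)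
  have hlevel : 0 ≤ V * (1 + ρG) * sys.ν :=
    mul_nonneg (mul_nonneg hV (by linarith)) sys.ν_nonneg
  have key : ∀ d, X.Q Fh B d ω
      + ∑ n, X.rate Fh n d ω * (X.start n (X.cur n d ω + 1) ω - X.t d ω)
      ≤ V * (1 + ρG) * sys.ν + b.rateMax ρF * b.TmaxAll := by
    intro d
    induction d with
    | zero => exact add_le_add hlevel (hsmall 0)
    | succ d ih =>
      rcases le_or_gt (X.Q Fh B (d + 1) ω) (V * (1 + ρG) * sys.ν) with hlow | hhigh
      · exact add_le_add hlow (hsmall (d + 1))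
      · have hstep : ∀ n,
            X.rate Fh n (d + 1) ω * (X.start n (X.cur n (d + 1) ω + 1) ω - X.t (d + 1) ω)
              ≤ X.rate Fh n d ω * (X.start n (X.cur n d ω + 1) ω - X.t d ω)
                - X.δ d ω * X.rate Fh n d ω := by
          intro n
          rcases h.cur_succ n d with ⟨h1, -⟩ | ⟨h1, h2⟩
          · have hr : X.rate Fh n (d + 1) ω = X.rate Fh n d ω := by
              show X.spend Fh n (X.cur n (d + 1) ω) ω = X.spend Fh n (X.cur n d ω) ω
              rw [h1]
            rw [h1, hr, δ]
            exact le_of_eq (by ring)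
          · have hr : X.rate Fh n (d + 1) ω = 0 := by
              show X.spend Fh n (X.cur n (d + 1) ω) ω = 0
              rw [spend, hopt.p_eq_zero hq hG hF hF1 hV (h.starts_of_cur_succ h1) hhigh, zero_div]
            rw [hr, ← h2, δ]
            exact le_of_eq (by ring)
        have hsum := Finset.sum_le_sum fun n (_ : n ∈ Finset.univ) => hstep n
        rw [Finset.sum_sub_distrib, ← Finset.mul_sum] at hsum
        linarith [h.Q_succ_le hq hF hF1 hB d]
  have h0 : 0 ≤ ∑ n, X.rate Fh n d ω * (X.start n (X.cur n d ω + 1) ω - X.t d ω) :=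
    Finset.sum_nonneg fun n _ => mul_nonneg (rate_mem hq hF hF1 n d).1 (hres n d)
  linarith [key d]

lemma rateMax_mul_le_cmaxHat (X : AdProcess sys μ) (h : X.IsRegular ω)
    (hq : sys.EstimationQuality Gh Fh ρG ρF) (hF : 0 ≤ ρF) (hF1 : ρF < 1) :
    b.rateMax ρF * b.TmaxAll ≤ 2 * b.cmaxHat B ρF := by
  have h0 := X.rateMax_nonneg ω hq hF hF1
  have hT := h.TmaxAll_pos
  have hm : b.rateMax ρF ≤ max (b.rateMax ρF) B := le_max_left _ _
  have h1 : b.cmaxHat B ρF = (1 + ρF) * (b.TmaxAll * max (b.rateMax ρF) B) := by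
    rw [Bounds.cmaxHat, Bounds.rateMax, mul_assoc]
  have h2 : b.rateMax ρF * b.TmaxAll ≤ b.TmaxAll * max (b.rateMax ρF) B := by
    rw [mul_comm]
    gcongr
  have h3 : 0 ≤ b.TmaxAll * max (b.rateMax ρF) B := mul_nonneg hT.le (h0.trans hm)
  rw [h1]
  nlinarith

/-- The queue changes at a bounded rate. -/
lemma IsRegular.abs_Q_sub_le (h : X.IsRegular ω) (hq : sys.EstimationQuality Gh Fh ρG ρF)
    (hF : 0 ≤ ρF) (hF1 : ρF < 1) (hB : 0 ≤ B) {e d : ℕ} (hed : e ≤ d) :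
    |X.Q Fh B d ω - X.Q Fh B e ω| ≤ (X.t d ω - X.t e ω) * (B + b.rateMax ρF) := by
  induction d, hed using Nat.le_induction with
  | base => simp
  | succ d _ ih =>
    have h1 := h.Q_succ_le hq hF hF1 hB d
    have h2 := le_Q_succ (X := X) (Fh := Fh) (B := B) (ω := ω) d
    obtain ⟨h3, h4⟩ := sum_rate_mem (X := X) (ω := ω) hq hF hF1 d
    have hδ := h.δ_pos d
    have h5 := mul_le_mul_of_nonneg_left h4 hδ.le
    have h6 := mul_nonneg hδ.le h3
    have h7 := mul_nonneg hδ.le hB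
    have h8 := mul_nonneg hδ.le (h3.trans h4)
    have h9 : X.t (d + 1) ω = X.t d ω + X.δ d ω := by rw [δ]; ring
    rw [abs_le] at ih ⊢
    rw [h9]
    constructor <;> linarith

/-- Drift bound: the time average of the queue times the excess of the consumption rate over the
budget is bounded from below, because the square of the queue stays nonnegative. -/
lemma IsRegular.drift (h : X.IsRegular ω) (hq : sys.EstimationQuality Gh Fh ρG ρF)
    (hF : 0 ≤ ρF) (hF1 : ρF < 1) (hB : 0 ≤ B) (D : ℕ) :
    2 * ∑ d ∈ Finset.range D, X.δ d ω * (X.Q Fh B d ω * (B - ∑ n, X.rate Fh n d ω))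
      ≤ b.TmaxAll * (B ^ 2 + b.rateMax ρF ^ 2) * X.t D ω := by
  have key : X.Q Fh B D ω ^ 2
      + 2 * ∑ d ∈ Finset.range D, X.δ d ω * (X.Q Fh B d ω * (B - ∑ n, X.rate Fh n d ω))
      ≤ b.TmaxAll * (B ^ 2 + b.rateMax ρF ^ 2) * X.t D ω := by
    induction D with
    | zero => simp [Q, t]
    | succ D ih =>
      rw [Finset.sum_range_succ]
      have h9 : X.t (D + 1) ω = X.t D ω + X.δ D ω := by rw [δ]; ring
      rw [h9, Q]
      obtain ⟨h3, h4⟩ := sum_rate_mem (X := X) (ω := ω) hq hF hF1 D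
      set r := ∑ n, X.rate Fh n D ω
      set q := X.Q Fh B D ω with hqd
      have hδ := h.δ_pos D
      have hT := h.TmaxAll_pos.le
      have hq0 : 0 ≤ q := h.Q_nonneg hq hF hF1 D
      set x := X.δ D ω
      have hx : x ≤ b.TmaxAll := h.δ_le_TmaxAll D
      -- The positive part only shrinks the square, and the cross term is at most `2 * q * x * r`.
      have m1 : max (q - x * B) 0 ≤ q := max_le (sub_le_self _ (mul_nonneg hδ.le hB)) hq0
      have m2 : max (q - x * B) 0 ^ 2 ≤ (q - x * B) ^ 2 := by
        rcases le_total (q - x * B) 0 with hle | hle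
        · rw [max_eq_right hle, zero_pow two_ne_zero]; exact sq_nonneg _
        · rw [max_eq_left hle]
      have m3 := mul_le_mul_of_nonneg_right m1 (mul_nonneg hδ.le h3)
      have m4 : x * (x * (B ^ 2 + r ^ 2)) ≤ x * (b.TmaxAll * (B ^ 2 + b.rateMax ρF ^ 2)) := by
        gcongr
      nlinarith
  linarith [sq_nonneg (X.Q Fh B D ω)]

/-- Every frame starts at a decision point. -/
lemma IsRegular.exists_decision (h : X.IsRegular ω) (n : Fin N) (d : ℕ) :
    ∃ e ≤ d, X.cur n e ω = X.cur n d ω ∧ X.t e ω = X.start n (X.cur n d ω) ω := by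
  induction d with
  | zero => exact ⟨0, le_rfl, rfl, by rw [cur_zero h, start_zero, t]⟩
  | succ d ih =>
    rcases h.cur_succ n d with ⟨h1, -⟩ | ⟨h1, h2⟩
    · obtain ⟨e, he, h3, h4⟩ := ih
      exact ⟨e, he.trans d.le_succ, by rw [h3, h1], by rw [h4, h1]⟩
    · exact ⟨d + 1, le_rfl, rfl, by rw [h1, h2]⟩

/-- At every decision point, the running frame of a site is nearly optimal for the current
queue, since the queue has changed only by a bounded amount since the frame was started. -/
lemma IsRegular.nearly_optimal (h : X.IsRegular ω) (hopt : X.Optimizes Gh Fh B V ω)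
    (hq : sys.EstimationQuality Gh Fh ρG ρF) (hF : 0 ≤ ρF) (hF1 : ρF < 1) (hB : 0 ≤ B)
    (n : Fin N) (d : ℕ) {p fr : ℝ} (hp : (p, fr) ∈ sys.P n) (m : M n) :
    V * (Gh n p m / (Fh n p m + fr)) - X.Q Fh B d ω * (p / (Fh n p m + fr))
      ≤ V * X.gain Gh Fh n (X.cur n d ω) ω - X.Q Fh B d ω * X.spend Fh n (X.cur n d ω) ω
        + b.TmaxAll * (B + b.rateMax ρF) * (b.pmax n / ((1 - ρF) * b.Tmin n)) := by
  obtain ⟨e, he, h1, h2⟩ := h.exists_decision n d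
  have h3 := hopt e n ⟨_, h2.symm⟩ p fr m hp
  rw [h1] at h3
  have h4 := h.abs_Q_sub_le hq hF hF1 hB he
  have h5 : (X.t d ω - X.t e ω) * (B + b.rateMax ρF) ≤ b.TmaxAll * (B + b.rateMax ρF) := by
    have := X.rateMax_nonneg ω hq hF hF1
    rw [h2]
    gcongr
    exact (h.t_sub_start_le n d).trans (b.Tmax_le_TmaxAll n)
  obtain ⟨a1, a2⟩ := hq.spend_mem hF hF1 hp m
  obtain ⟨a3, a4⟩ := spend_mem (X := X) (ω := ω) hq hF hF1 n (X.cur n d ω)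
  set x := p / (Fh n p m + fr)
  set y := X.spend Fh n (X.cur n d ω) ω
  have h6 : |(X.Q Fh B d ω - X.Q Fh B e ω) * (y - x)|
      ≤ b.TmaxAll * (B + b.rateMax ρF) * (b.pmax n / ((1 - ρF) * b.Tmin n)) := by
    rw [abs_mul]
    exact mul_le_mul (h4.trans h5) (abs_le.2 ⟨by linarith, by linarith⟩) (abs_nonneg _)
      ((abs_nonneg _).trans (h4.trans h5))
  have h7 := (abs_le.1 h6).2
  linarith

end AdProcess

/-! ### Long run performance of the algorithm -/

namespace AdProcess

variable {N : ℕ} {b : Bounds N} {M : Fin N → Type u}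
  [∀ n, TopologicalSpace (M n)] [∀ n, CompactSpace (M n)]
  [∀ n, MeasurableSpace (M n)] [∀ n, BorelSpace (M n)]
  {Ω : Type v} [mΩ : MeasurableSpace Ω]
  {sys : AdSystem b M} {μ : Measure Ω} {X : AdProcess sys μ}
  {Gh Fh : (n : Fin N) → ℝ → M n → ℝ} {ρG ρF B V : ℝ} {ω : Ω}

/-- The queue records all expenditure in excess of the budget, so the time average of the
consumption rate exceeds the budget by at most `Q / t`. -/
lemma sum_rate_le (D : ℕ) :
    ∑ d ∈ Finset.range D, X.δ d ω * ∑ n, X.rate Fh n d ω ≤ B * X.t D ω + X.Q Fh B D ω := by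
  induction D with
  | zero => simp [Q, t]
  | succ D ih =>
    rw [Finset.sum_range_succ]
    have h1 := le_Q_succ (X := X) (Fh := Fh) (B := B) (ω := ω) D
    have h9 : X.t (D + 1) ω = X.t D ω + X.δ D ω := by rw [δ]; ring
    rw [h9]
    linarith

lemma sum_δ_sum_div (f : Fin N → ℕ → ℝ) (D : ℕ) :
    (∑ d ∈ Finset.range D, X.δ d ω * ∑ n, f n (X.cur n d ω)) / X.t D ω
      = ∑ n, (∑ d ∈ Finset.range D, X.δ d ω * f n (X.cur n d ω)) / X.t D ω := by
  simp_rw [Finset.mul_sum]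
  rw [Finset.sum_comm, Finset.sum_div]

variable [NeZero N]

/-- The time average of the estimated revenue rate of the frames is asymptotically at most a
multiple of the time average revenue. -/
lemma ae_exists_gain_le [IsProbabilityMeasure μ] (hlim : X.HasTimeAverages)
    (hq : sys.EstimationQuality Gh Fh ρG ρF) (hG : 0 ≤ ρG) (hG1 : ρG < 1)
    (hF : 0 ≤ ρF) (hF1 : ρF < 1) :
    ∀ᵐ ω ∂μ, ∃ r : ℕ → ℝ, Tendsto r atTop (𝓝 ((1 + ρG) / (1 - ρF) * X.profit ω)) ∧
      ∀ D, 1 ≤ D → (∑ d ∈ Finset.range D, X.δ d ω * ∑ n, X.gain Gh Fh n (X.cur n d ω) ω)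
        / X.t D ω ≤ r D := by
  have hw : ∀ n, Measurable fun a : ℝ × ℝ × M n => Gh n a.1 a.2.2 / (Fh n a.1 a.2.2 + a.2.1) := by
    intro n
    have h1 : Measurable fun a : ℝ × ℝ × M n => (a.1, a.2.2) := by fun_prop
    exact ((hq.Gh_meas n).comp h1).div (((hq.Fh_meas n).comp h1).add (by fun_prop))
  filter_upwards [X.ae_frameLen_mem, hlim, ae_all_iff.2 X.ae_tendsto_avg_revenue,
    ae_all_iff.2 fun n => X.ae_tendsto_avg_time n (hw n)
      (fun p fr m hp => hq.abs_gain_le hG hG1 hF hF1 hp m)] with ω hreg hlim hrev htime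
  have hreg : X.IsRegular ω := hreg
  have hsite : ∀ n, ∃ r : ℕ → ℝ, Tendsto r atTop (𝓝 ((1 + ρG) / (1 - ρF) *
      (limUnder atTop (avg fun k => X.R n k ω) / limUnder atTop (avg fun k => X.frameLen n k ω))))
      ∧ ∀ D, 1 ≤ D → (∑ d ∈ Finset.range D, X.δ d ω * X.gain Gh Fh n (X.cur n d ω) ω)
        / X.t D ω ≤ r D := by
    intro n
    obtain ⟨⟨ρ, hρ⟩, -, ⟨τ, hτ⟩⟩ := hlim n
    rw [hρ.limUnder_eq, hτ.limUnder_eq, ← mul_div_assoc]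
    -- A frame contributes `gain * frameLen = gain * (F + fr) + gain * (Tad - F)`, where
    -- `gain * (F + fr) ≤ (1 + ρG) / (1 - ρF) * G`; replacing `G` by `R` costs another term that
    -- averages out.
    have hw' : Tendsto (avg fun k => (1 + ρG) / (1 - ρF) * X.R n k ω) atTop
        (𝓝 ((1 + ρG) / (1 - ρF) * ρ)) :=
      (hρ.const_mul _).congr fun K => (avg_const_mul _ _ K).symm
    have he : Tendsto (avg fun k => X.gain Gh Fh n k ω *
          (X.Tad n k ω - sys.F n (X.p n k ω) (X.m n k ω))
        - (1 + ρG) / (1 - ρF) * (X.R n k ω - sys.G n (X.p n k ω) (X.m n k ω)))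
        atTop (𝓝 0) := by
      have h1 := (htime n).sub ((hrev n).const_mul ((1 + ρG) / (1 - ρF)))
      rw [mul_zero, sub_zero] at h1
      refine h1.congr fun K => ?_
      rw [← avg_const_mul]
      exact (avg_sub _ _ K).symm
    refine hreg.exists_time_avg_le hτ
      (fun k => hq.abs_gain_le hG hG1 hF hF1 (X.action_mem n k ω) (X.m n k ω)) hw' he
      fun k => ?_
    have hmem := X.action_mem n k ω
    have hlen := hq.le_len hF hmem (X.m n k ω)
    have hpos := hq.len_pos hF hF1 hmem (X.m n k ω)
    have hGh := hq.Gh_le hmem (X.m n k ω)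
    have hGh0 := (mul_nonneg (by linarith) (sys.G_nonneg n _ _ (X.m n k ω) hmem)).trans
      (hq.le_Gh hmem (X.m n k ω))
    have hmean : X.gain Gh Fh n k ω * (sys.F n (X.p n k ω) (X.m n k ω) + X.fr n k ω)
        ≤ (1 + ρG) / (1 - ρF) * sys.G n (X.p n k ω) (X.m n k ω) := by
      have hρ1 : 0 < 1 - ρF := sub_pos.2 hF1
      rw [gain, div_mul_eq_mul_div, div_mul_eq_mul_div, div_le_div_iff₀ hpos hρ1]
      have h1 := mul_le_mul_of_nonneg_left hlen hGh0
      have h2 := mul_le_mul_of_nonneg_right hGh hpos.le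
      linarith
    rw [gain] at hmean ⊢
    rw [frameLen]
    linarith
  choose r hr hle using hsite
  refine ⟨fun D => ∑ n, r n D, ?_, fun D hD => ?_⟩
  · rw [profit, Finset.mul_sum]
    exact tendsto_finsetSum _ fun n _ => hr n
  · rw [sum_δ_sum_div fun n k => X.gain Gh Fh n k ω]
    exact Finset.sum_le_sum fun n _ => hle n D hD

/-- The time average of the estimated consumption rate is asymptotically at least the time
average expenditure up to the factor `1 / (1 + ρF)`. -/
lemma ae_exists_rate_ge [IsProbabilityMeasure μ] (hlim : X.HasTimeAverages)
    (hq : sys.EstimationQuality Gh Fh ρG ρF) (hF : 0 ≤ ρF) (hF1 : ρF < 1) :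
    ∀ᵐ ω ∂μ, ∃ r : ℕ → ℝ, Tendsto r atTop (𝓝 (X.expenditure ω / (1 + ρF))) ∧
      ∀ D, 1 ≤ D → r D ≤
        (∑ d ∈ Finset.range D, X.δ d ω * ∑ n, X.rate Fh n d ω) / X.t D ω := by
  have hw : ∀ n, Measurable fun a : ℝ × ℝ × M n => - (a.1 / (Fh n a.1 a.2.2 + a.2.1)) := by
    intro n
    have h1 : Measurable fun a : ℝ × ℝ × M n => (a.1, a.2.2) := by fun_prop
    exact (measurable_fst.div (((hq.Fh_meas n).comp h1).add (by fun_prop))).neg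
  have hwb : ∀ n p fr m, (p, fr) ∈ sys.P n →
      |-(p / (Fh n p m + fr))| ≤ b.pmax n / ((1 - ρF) * b.Tmin n) := by
    intro n p fr m hp
    rw [abs_neg, abs_of_nonneg (hq.spend_mem hF hF1 hp m).1]
    exact (hq.spend_mem hF hF1 hp m).2
  filter_upwards [X.ae_frameLen_mem, hlim,
    ae_all_iff.2 fun n => X.ae_tendsto_avg_time n (hw n) (hwb n)] with ω hreg hlim htime
  have hreg : X.IsRegular ω := hreg
  have hsite : ∀ n, ∃ r : ℕ → ℝ, Tendsto r atTop (𝓝 (-(1 / (1 + ρF)) *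
      (limUnder atTop (avg fun k => X.p n k ω) / limUnder atTop (avg fun k => X.frameLen n k ω))))
      ∧ ∀ D, 1 ≤ D → (∑ d ∈ Finset.range D, X.δ d ω * -X.spend Fh n (X.cur n d ω) ω)
        / X.t D ω ≤ r D := by
    intro n
    obtain ⟨-, ⟨q, hp⟩, ⟨τ, hτ⟩⟩ := hlim n
    rw [hp.limUnder_eq, hτ.limUnder_eq, ← mul_div_assoc]
    -- The upper bound for time averages is applied to `-spend`, which gives a lower bound for
    -- `spend`.
    have hw' : Tendsto (avg fun k => -(1 / (1 + ρF)) * X.p n k ω) atTop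
        (𝓝 (-(1 / (1 + ρF)) * q)) :=
      (hp.const_mul _).congr fun K => (avg_const_mul _ _ K).symm
    refine hreg.exists_time_avg_le (f := fun k => -X.spend Fh n k ω) hτ
      (fun k => hwb n _ _ (X.m n k ω) (X.action_mem n k ω)) hw' (htime n) fun k => ?_
    have hmem := X.action_mem n k ω
    have hlen := hq.len_le hF hmem (X.m n k ω)
    have hpos := hq.len_pos hF hF1 hmem (X.m n k ω)
    have hp0 := (sys.P_bounds n _ _ hmem).1
    have hmean : 1 / (1 + ρF) * X.p n k ω
        ≤ X.spend Fh n k ω * (sys.F n (X.p n k ω) (X.m n k ω) + X.fr n k ω) := by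
      rw [spend, div_mul_eq_mul_div, div_mul_eq_mul_div, div_le_div_iff₀ (by linarith) hpos]
      have h1 := mul_le_mul_of_nonneg_left hlen hp0
      linarith
    rw [spend] at hmean ⊢
    rw [frameLen]
    simp only [action]
    linarith
  choose r hr hle using hsite
  refine ⟨fun D => -∑ n, r n D, ?_, fun D hD => ?_⟩
  · have h1 := (tendsto_finsetSum Finset.univ fun n _ => hr n).neg
    rw [← Finset.mul_sum] at h1
    rw [expenditure]
    convert h1 using 2
    ring
  · have h1 := Finset.sum_le_sum fun n (_ : n ∈ Finset.univ) => hle n D hD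
    rw [← sum_δ_sum_div fun n k => -X.spend Fh n k ω] at h1
    simp only [Finset.sum_neg_distrib, mul_neg, neg_div] at h1
    exact neg_le.1 h1

lemma expenditure_le_of_rate {r : ℕ → ℝ} {q : ℝ} (h : X.IsRegular ω) (hF : 0 ≤ ρF)
    (hQ : ∀ d, X.Q Fh B d ω ≤ q)
    (hr : Tendsto r atTop (𝓝 (X.expenditure ω / (1 + ρF))))
    (hle : ∀ D, 1 ≤ D → r D ≤
        (∑ d ∈ Finset.range D, X.δ d ω * ∑ n, X.rate Fh n d ω) / X.t D ω) :
    X.expenditure ω ≤ (1 + ρF) * B := by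
  have h1 : Tendsto (fun D => B + q / X.t D ω) atTop (𝓝 (B + 0)) :=
    tendsto_const_nhds.add (h.tendsto_t.const_div_atTop q)
  have h2 : X.expenditure ω / (1 + ρF) ≤ B + 0 := by
    refine le_of_tendsto_of_tendsto hr h1 ?_
    filter_upwards [eventually_ge_atTop 1] with D hD
    have ht := h.t_pos hD
    refine (hle D hD).trans ?_
    rw [div_le_iff₀ ht, add_mul, div_mul_cancel₀ _ ht.ne']
    exact (sum_rate_le (B := B) D).trans (by linarith [hQ D])
  rw [add_zero, div_le_iff₀ (by linarith)] at h2
  linarith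

/-- Comparison of the algorithm with the optimum up to the `D`-th decision point. The time average
of the queue, divided by `V`, serves as the price of investments in the dual bound for the optimal
profit. -/
lemma IsRegular.optProfit_le (h : X.IsRegular ω) (hopt : X.Optimizes Gh Fh B V ω)
    (hq : sys.EstimationQuality Gh Fh ρG ρF) (hG : 0 ≤ ρG) (hF : 0 ≤ ρF)
    (hF1 : ρF < 1) (hB : 0 ≤ B) (hV : 0 < V) {D : ℕ} (hD : 1 ≤ D) :
    sys.optProfit B ≤ (1 + ρF) *
      ((∑ d ∈ Finset.range D, X.δ d ω * ∑ n, X.gain Gh Fh n (X.cur n d ω) ω) / X.t D ω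
        + b.defect B ρF / V + N * (ρG * sys.Gmax / ((1 - ρF) * b.TminAll))) := by
  have ht := h.t_pos hD
  set T := X.t D ω with hTdef
  set q := ∑ d ∈ Finset.range D, X.δ d ω * X.Q Fh B d ω with hqdef
  have hq0 : 0 ≤ q := Finset.sum_nonneg fun d _ =>
    mul_nonneg (h.δ_pos d).le (h.Q_nonneg hq hF hF1 d)
  set lam := q / (T * V) with hlam
  have hlam0 : 0 ≤ lam := div_nonneg hq0 (mul_pos ht hV).le
  have hTV : 0 < T * V := mul_pos ht hV
  obtain ⟨L, hL⟩ : ∃ L, L = b.TmaxAll * (B + b.rateMax ρF) := ⟨_, rfl⟩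
  set A : Fin N → ℝ := fun n => ∑ d ∈ Finset.range D, X.δ d ω *
    (V * X.gain Gh Fh n (X.cur n d ω) ω - X.Q Fh B d ω * X.spend Fh n (X.cur n d ω) ω)
    + T * (L * (b.pmax n / ((1 - ρF) * b.Tmin n))) with hA
  -- The time integral of the near optimality of the running frames.
  have hint : ∀ n p fr m, (p, fr) ∈ sys.P n →
      Gh n p m / (Fh n p m + fr) - lam * (p / (Fh n p m + fr)) ≤ A n / (T * V) := by
    intro n p fr m hp
    have h0 := fun d => h.nearly_optimal hopt hq hF hF1 hB n d hp m
    rw [← hL] at h0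
    have h1 := Finset.sum_le_sum fun d (_ : d ∈ Finset.range D) =>
      mul_le_mul_of_nonneg_left (h0 d) (h.δ_pos d).le
    rw [le_div_iff₀ hTV]
    set x := Gh n p m / (Fh n p m + fr)
    set y := p / (Fh n p m + fr)
    have h2 : ∑ d ∈ Finset.range D, X.δ d ω * (V * x - X.Q Fh B d ω * y)
        = T * (V * x) - q * y := by
      rw [hTdef, ← sum_δ, hqdef, Finset.sum_mul, Finset.sum_mul, ← Finset.sum_sub_distrib]
      exact Finset.sum_congr rfl fun d _ => by ring
    rw [h2] at h1
    simp only [mul_add, Finset.sum_add_distrib, ← Finset.sum_mul] at h1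
    rw [sum_δ, ← hTdef] at h1
    have h3 : lam * (T * V) = q := div_mul_cancel₀ _ hTV.ne'
    calc (x - lam * y) * (T * V) = T * (V * x) - lam * (T * V) * y := by ring
      _ ≤ A n := by rw [h3]; exact h1
  have hmin : 0 < (1 - ρF) * b.TminAll := mul_pos (sub_pos.2 hF1) b.TminAll_pos
  have hGmax : 0 < sys.Gmax := sys.Gmax_pos (X.action_mem 0 0 ω) (X.m 0 0 ω)
  have herr : 0 ≤ ρG * sys.Gmax / ((1 - ρF) * b.TminAll) :=
    div_nonneg (mul_nonneg hG hGmax.le) hmin.le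
  -- Not investing is feasible, so the bounds `A n / (T * V)` are nonnegative.
  have hA0 : ∀ n, 0 ≤ A n / (T * V) := by
    intro n
    obtain ⟨fr, hfr⟩ := sys.P_zero n
    have h1 := hint n 0 fr (X.m n 0 ω) hfr
    rwa [hq.Gh_zero hfr, zero_div, mul_zero, sub_zero] at h1
  have hdual : ∀ n p fr m, (p, fr) ∈ sys.P n → sys.G n p m - lam * p
      ≤ (1 + ρF) * (A n / (T * V) + ρG * sys.Gmax / ((1 - ρF) * b.TminAll))
        * (sys.F n p m + fr) := by
    intro n p fr m hp
    have hlen := hq.len_le hF hp m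
    have hpos := hq.len_pos hF hF1 hp m
    have h1 := hint n p fr m hp
    rw [← mul_div_assoc, ← sub_div, div_le_iff₀ hpos] at h1
    have h2 : ρG * sys.Gmax ≤ ρG * sys.Gmax / ((1 - ρF) * b.TminAll) * (Fh n p m + fr) := by
      rw [div_mul_eq_mul_div, le_div_iff₀ hmin]
      refine mul_le_mul_of_nonneg_left ?_ (mul_nonneg hG hGmax.le)
      exact (mul_le_mul_of_nonneg_left (b.TminAll_le_Tmin n) (sub_nonneg.2 hF1.le)).trans
        (hq.Tmin_le_len hF hF1 hp m)
    have h3 : sys.G n p m ≤ Gh n p m + ρG * sys.Gmax := by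
      have := mul_le_mul_of_nonneg_left (sys.G_lt n p fr m hp).le hG
      linarith [hq.le_Gh hp m]
    calc sys.G n p m - lam * p
        ≤ (A n / (T * V) + ρG * sys.Gmax / ((1 - ρF) * b.TminAll)) * (Fh n p m + fr) := by
          rw [add_mul]; linarith
      _ ≤ (A n / (T * V) + ρG * sys.Gmax / ((1 - ρF) * b.TminAll))
            * ((1 + ρF) * (sys.F n p m + fr)) :=
          mul_le_mul_of_nonneg_left hlen (add_nonneg (hA0 n) herr)
      _ = _ := by ring
  have hweak := sys.optProfit_le hB hlam0
    (fun n => mul_nonneg (by linarith) (add_nonneg (hA0 n) herr)) hdual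
  rw [← Finset.mul_sum, Finset.sum_add_distrib, ← Finset.sum_div, Finset.sum_const,
    Finset.card_univ, Fintype.card_fin, nsmul_eq_mul] at hweak
  set S := ∑ d ∈ Finset.range D, X.δ d ω * ∑ n, X.gain Gh Fh n (X.cur n d ω) ω with hS
  have hAsum : ∑ n, A n = V * S
      - ∑ d ∈ Finset.range D, X.δ d ω * (X.Q Fh B d ω * ∑ n, X.rate Fh n d ω)
      + T * (L * b.rateMax ρF) := by
    have h1 : ∑ n, ∑ d ∈ Finset.range D, X.δ d ω *
        (V * X.gain Gh Fh n (X.cur n d ω) ω - X.Q Fh B d ω * X.spend Fh n (X.cur n d ω) ω)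
        = V * S - ∑ d ∈ Finset.range D, X.δ d ω * (X.Q Fh B d ω * ∑ n, X.rate Fh n d ω) := by
      rw [Finset.sum_comm, hS, Finset.mul_sum, ← Finset.sum_sub_distrib]
      refine Finset.sum_congr rfl fun d _ => ?_
      rw [← Finset.mul_sum, Finset.sum_sub_distrib, ← Finset.mul_sum, ← Finset.mul_sum]
      have : ∑ n, X.spend Fh n (X.cur n d ω) ω = ∑ n, X.rate Fh n d ω := rfl
      rw [this]
      ring
    rw [hA, Finset.sum_add_distrib, h1, ← Finset.mul_sum, ← Finset.mul_sum, Bounds.rateMax]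
  have hdrift := h.drift hq hF hF1 hB D
  have hsplit : ∑ d ∈ Finset.range D, X.δ d ω * (X.Q Fh B d ω * (B - ∑ n, X.rate Fh n d ω))
      = B * q - ∑ d ∈ Finset.range D, X.δ d ω * (X.Q Fh B d ω * ∑ n, X.rate Fh n d ω) := by
    rw [hqdef, Finset.mul_sum, ← Finset.sum_sub_distrib]
    exact Finset.sum_congr rfl fun d _ => by ring
  rw [hsplit] at hdrift
  have hAle : ∑ n, A n ≤ V * S - B * q + T * b.defect B ρF := by
    rw [hAsum, Bounds.defect, ← hL]
    linarith
  have hAdiv : (∑ n, A n) / (T * V) ≤ S / T - B * lam + b.defect B ρF / V := by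
    rw [div_le_iff₀ hTV]
    refine hAle.trans (le_of_eq ?_)
    rw [hlam]
    field_simp
  have h1 := mul_le_mul_of_nonneg_left hAdiv (by linarith : (0 : ℝ) ≤ 1 + ρF)
  have h2 : 0 ≤ ρF * (B * lam) := mul_nonneg hF (mul_nonneg hB hlam0)
  linarith

end AdProcess

end

theorem theorem3 {N : ℕ} [NeZero N] (b : Bounds N) (B : ℝ) (hB : 0 ≤ B)
    (ρG ρF : ℝ) (hG : 0 ≤ ρG) (hG1 : ρG < 1) (hF : 0 ≤ ρF) (hF1 : ρF < 1) :
    ∃ C : ℝ, 0 < C ∧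
      ∀ (M : Fin N → Type u) [∀ n, TopologicalSpace (M n)] [∀ n, CompactSpace (M n)]
        [∀ n, MeasurableSpace (M n)] [∀ n, BorelSpace (M n)]
        (sys : AdSystem b M) (Gh Fh : (n : Fin N) → ℝ → M n → ℝ),
        sys.EstimationQuality Gh Fh ρG ρF →
      ∀ (V : ℝ), 1 ≤ V →
      ∀ (Ω : Type v) [MeasurableSpace Ω] (μ : Measure Ω) [IsProbabilityMeasure μ]
        (X : AdProcess sys μ), X.HasTimeAverages → X.IsAdInvestment Gh Fh B V →
        (∀ᵐ ω ∂μ,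
          (1 - ρF) / ((1 + ρF) * (1 + ρG)) * sys.optProfit B - C / V
              - N * ρG * sys.Gmax / ((1 + ρG) * b.TminAll)
            ≤ X.profit ω) ∧
        (∀ᵐ ω ∂μ, ∀ d, X.Q Fh B d ω ≤ V * (1 + ρG) * sys.ν + 2 * b.cmaxHat B ρF) ∧
        (∀ᵐ ω ∂μ, X.expenditure ω ≤ (1 + ρF) * B) := by
  refine ⟨|b.defect B ρF| + 1, by positivity, ?_⟩
  intro M _ _ _ _ sys Gh Fh hq V hV Ω _ μ _ X hlim hAI
  have hV0 : 0 < V := by linarith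
  refine ⟨?_, ?_, ?_⟩
  · filter_upwards [X.ae_frameLen_mem, hAI.ae_optimizes,
      AdProcess.ae_exists_gain_le hlim hq hG hG1 hF hF1] with ω hreg hopt ⟨r, hr, hle⟩
    have hreg : X.IsRegular ω := hreg
    have hbound : sys.optProfit B ≤ (1 + ρF) * ((1 + ρG) / (1 - ρF) * X.profit ω
        + b.defect B ρF / V + N * (ρG * sys.Gmax / ((1 - ρF) * b.TminAll))) := by
      refine ge_of_tendsto (((hr.add_const _).add_const _).const_mul (1 + ρF)) ?_
      filter_upwards [eventually_ge_atTop 1] with D hD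
      refine (hreg.optProfit_le hopt hq hG hF hF1 hB hV0 hD).trans ?_
      have := hle D hD
      gcongr
    have hρ : 0 < 1 - ρF := sub_pos.2 hF1
    have hρ' : 0 < 1 + ρF := by linarith
    have hρG : 0 < 1 + ρG := by linarith
    have hT := b.TminAll_pos
    have hfactor : 0 ≤ (1 - ρF) / ((1 + ρF) * (1 + ρG)) := by positivity
    have h1 := mul_le_mul_of_nonneg_left hbound hfactor
    have h2 : (1 - ρF) / ((1 + ρF) * (1 + ρG)) * ((1 + ρF) * ((1 + ρG) / (1 - ρF) * X.profit ω
        + b.defect B ρF / V + N * (ρG * sys.Gmax / ((1 - ρF) * b.TminAll))))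
        = X.profit ω + (1 - ρF) / (1 + ρG) * (b.defect B ρF / V)
          + N * ρG * sys.Gmax / ((1 + ρG) * b.TminAll) := by
      field_simp
    have h3 : (1 - ρF) / (1 + ρG) * (b.defect B ρF / V)
        ≤ (|b.defect B ρF| + 1) / V := by
      have h4 : (1 - ρF) / (1 + ρG) ≤ 1 := (div_le_one hρG).2 (by linarith)
      calc (1 - ρF) / (1 + ρG) * (b.defect B ρF / V)
          ≤ 1 * ((|b.defect B ρF| + 1) / V) := by
            refine mul_le_mul_of_nonneg h4 ?_ (by positivity) (by positivity)
            gcongr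
            linarith [le_abs_self (b.defect B ρF)]
        _ = _ := one_mul _
    linarith
  · filter_upwards [X.ae_frameLen_mem, hAI.ae_optimizes] with ω hreg hopt d
    exact (AdProcess.IsRegular.Q_le hreg hopt hq hG hF hF1 hB hV0.le d).trans
      (by linarith [X.rateMax_mul_le_cmaxHat (B := B) hreg hq hF hF1])
  · filter_upwards [X.ae_frameLen_mem, hAI.ae_optimizes,
      AdProcess.ae_exists_rate_ge hlim hq hF hF1] with ω hreg hopt ⟨r, hr, hle⟩
    exact AdProcess.expenditure_le_of_rate hreg hF
      (AdProcess.IsRegular.Q_le hreg hopt hq hG hF hF1 hB hV0.le) hr hle
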